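/- Let $m\ge 3$. Let $\mathcal{W}(m)=(\mathbb{R}^m)^*\otimes(\mathbb{R}^m)^*\otimes\mathbb{R}^m$ be the space of constant Christoffel symbols $\Gamma=(\Gamma_{ij}{}^k)$ on $\mathbb{R}^m$, and let $\mathcal{Z}(m)\subset\mathcal{W}(m)$ be the linear subspace of torsion free ones, $\Gamma_{ij}{}^k=\Gamma_{ji}{}^k$. The Ricci tensor of $\Gamma$ is $\rho_{\Gamma,jk}=\sum_{i,n}(\Gamma_{in}{}^i\Gamma_{jk}{}^n-\Gamma_{jn}{}^i\Gamma_{ik}{}^n)$ and its symmetrization is $\rho_{s,\Gamma,jk}=\frac12(\rho_{\Gamma,jk}+\rho_{\Gamma,kj})$. Let $\mathcal{W}(p,q)$ (respectively $\mathcal{Z}(p,q)$) be the set of $\Gamma$ in $\mathcal{W}(m)$ (respectively $\mathcal{Z}(m)$) such that $\rho_{s,\Gamma}$ has signature $(p,q)$, i.e. $p$ negative and $q$ positive directions. The group $\mathrm{GL}^+(m,\mathbb{R})$ of linear maps of positive determinant acts on these spaces by linear change of coordinates, $(T\Gamma)(x,y)=T\,\Gamma(T^{-1}x,T^{-1}y)$.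 Let $G_\Gamma^+=\{T\in\mathrm{GL}^+(m,\mathbb{R}):T\Gamma=\Gamma\}$ be the isotropy group of $\Gamma$, and let $$\tilde{\mathcal{W}}(p,q)=\{\Gamma\in\mathcal{W}(p,q):G_\Gamma^+=\{\mathrm{id}\}\},\qquad \tilde{\mathcal{Z}}(p,q)=\{\Gamma\in\mathcal{Z}(p,q):G_\Gamma^+=\{\mathrm{id}\}\},$$ $$\tilde{\mathfrak{W}}^+(p,q)=\tilde{\mathcal{W}}(p,q)/\mathrm{GL}^+(m,\mathbb{R}),\qquad \tilde{\mathfrak{Z}}^+(p,q)=\tilde{\mathcal{Z}}(p,q)/\mathrm{GL}^+(m,\mathbb{R}).$$ Let $(p,q)\in\{(m,0),(0,m)\}$. Then: 1. The action of $\mathrm{GL}^+(m,\mathbb{R})$ on $\mathcal{W}(p,q)$ and on $\mathcal{Z}(p,q)$ is proper: if $\Gamma_n\to\Gamma$ and $T_n\Gamma_n\to\tilde\Gamma$ in the space, then a subsequence of $(T_n)$ converges in $\mathrm{GL}^+(m,\mathbb{R})$. 2. $\tilde{\mathcal{W}}(p,q)$ and $\tilde{\mathcal{Z}}(p,q)$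 are open dense subsets of $\mathcal{W}(p,q)$ and $\mathcal{Z}(p,q)$, respectively. 3. $\tilde{\mathcal{W}}(p,q)$ and $\tilde{\mathcal{Z}}(p,q)$ are open in $\mathcal{W}(m)$ and $\mathcal{Z}(m)$, and the moduli spaces $\tilde{\mathfrak{W}}^+(p,q)$ and $\tilde{\mathfrak{Z}}^+(p,q)$, with the quotient topology, are Hausdorff and second countable and carry natural smooth structures (a function on an open subset of the quotient is smooth if and only if its pullback is smooth) such that $\tilde{\mathcal{W}}(p,q)\to\tilde{\mathfrak{W}}^+(p,q)$ and $\tilde{\mathcal{Z}}(p,q)\to\tilde{\mathfrak{Z}}^+(p,q)$ are smooth principal $\mathrm{GL}^+(m,\mathbb{R})$-bundles. -/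

import Mathlib

open Filter Topology
open scoped Manifold ContDiff Matrix MatrixGroups

noncomputable section

/-! ### Constant Christoffel symbols and the action of the general linear group -/

/-- The space `𝒲(m)` of constant Christoffel symbols on `ℝ^m`; `Γ i j k` is `Γ_{ij}^k`. -/
def Christoffel (m : ℕ) : Type := Fin m → Fin m → Fin m → ℝ

namespace Christoffel

variable {m : ℕ}

instance : NormedAddCommGroup (Christoffel m) :=
  inferInstanceAs (NormedAddCommGroup (Fin m → Fin m → Fin m → ℝ))

instance : NormedSpace ℝ (Christoffel m) :=
  inferInstanceAs (NormedSpace ℝ (Fin m → Fin m → Fin m → ℝ))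

instance : FiniteDimensional ℝ (Christoffel m) :=
  inferInstanceAs (FiniteDimensional ℝ (Fin m → Fin m → Fin m → ℝ))

/-- Christoffel symbols in the frame `T e_1, …, T e_m`:
`(changeFrame T Γ)(e_i, e_j, e^k) = Γ(T e_i, T e_j, T e^k)`, where `T e_i = ∑ a, T a i • e_a` and
`T e^1, …, T e^m` is the basis dual to `T e_1, …, T e_m`, i.e. `T e^k = ∑ c, T⁻¹ k c • e^c`. -/
def changeFrame (T : GL (Fin m) ℝ) (Γ : Christoffel m) : Christoffel m := fun i j k =>
  ∑ a, ∑ b, ∑ c, T.1 a i * T.1 b j * T⁻¹.1 k c * Γ a b c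

theorem changeFrame_eq (T : GL (Fin m) ℝ) (Γ : Christoffel m) (i : Fin m) :
    (Matrix.of (changeFrame T Γ i) : Matrix (Fin m) (Fin m) ℝ) =
      T.1ᵀ * (∑ a, T.1 a i • Matrix.of (Γ a)) * T⁻¹.1ᵀ := by
  ext j k
  simp only [changeFrame, Matrix.of_apply, Matrix.mul_apply, Matrix.sum_apply, Matrix.smul_apply,
    Matrix.transpose_apply, smul_eq_mul, Finset.mul_sum, Finset.sum_mul]
  calc
    _ = ∑ a, ∑ c, ∑ b, T.1 a i * T.1 b j * T⁻¹.1 k c * Γ a b c :=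
        Finset.sum_congr rfl fun a _ => Finset.sum_comm
    _ = ∑ c, ∑ a, ∑ b, T.1 a i * T.1 b j * T⁻¹.1 k c * Γ a b c := Finset.sum_comm
    _ = _ := Finset.sum_congr rfl fun c _ => ?_
  exact Finset.sum_congr rfl fun a _ => Finset.sum_congr rfl fun b _ => by ring

theorem changeFrame_one (Γ : Christoffel m) : changeFrame 1 Γ = Γ := by
  funext i
  refine Matrix.of.injective ?_
  rw [changeFrame_eq]
  simp [Matrix.one_apply]

theorem changeFrame_mul (S T : GL (Fin m) ℝ) (Γ : Christoffel m) :
    changeFrame (S * T) Γ = changeFrame T (changeFrame S Γ) := by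
  funext i
  refine Matrix.of.injective ?_
  simp only [changeFrame_eq]
  simp only [mul_inv_rev, Units.val_mul, Matrix.transpose_mul, Matrix.mul_sum, Matrix.sum_mul,
    Matrix.mul_smul, Matrix.smul_mul, Matrix.mul_assoc, Matrix.mul_apply, Finset.sum_smul,
    Finset.smul_sum, smul_smul]
  rw [Finset.sum_comm]
  refine Finset.sum_congr rfl fun a _ => Finset.sum_congr rfl fun b _ => ?_
  rw [mul_comm]

/-- The action of the general linear group on Christoffel symbols by linear changes of
coordinates. As `changeFrame` reverses products, the inverse appears in the left action:
`(T • Γ)(x, y) = T (Γ (T⁻¹ x, T⁻¹ y))`. -/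
instance : MulAction (GL (Fin m) ℝ) (Christoffel m) where
  smul T Γ := changeFrame T⁻¹ Γ
  one_smul Γ := by
    change changeFrame 1⁻¹ Γ = Γ
    rw [inv_one, changeFrame_one]
  mul_smul S T Γ := by
    change changeFrame (S * T)⁻¹ Γ = changeFrame S⁻¹ (changeFrame T⁻¹ Γ)
    rw [mul_inv_rev, changeFrame_mul]

theorem smul_def (T : GL (Fin m) ℝ) (Γ : Christoffel m) : T • Γ = changeFrame T⁻¹ Γ := rfl

/-! ### The Ricci tensor and its signature -/

/-- The Ricci tensor `ρ_{jk} = Γ_{in}^i Γ_{jk}^n - Γ_{jn}^i Γ_{ik}^n` of the connection on `ℝ^m`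
with constant Christoffel symbols `Γ`. -/
def ricci (Γ : Christoffel m) : Matrix (Fin m) (Fin m) ℝ := Matrix.of fun j k =>
  ∑ i, ∑ n, (Γ i n i * Γ j k n - Γ j n i * Γ i k n)

/-- The symmetric Ricci tensor. -/
def symRicci (Γ : Christoffel m) : Matrix (Fin m) (Fin m) ℝ :=
  (1 / 2 : ℝ) • (Γ.ricci + Γ.ricciᵀ)

/-- The symmetric Ricci tensor has signature `(p, q)`: `p` timelike (negative) and
`q` spacelike (positive) directions. -/
def HasSignature (Γ : Christoffel m) (p q : ℕ) : Prop :=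
  sigNeg Γ.symRicci.toQuadraticForm' = p ∧ sigPos Γ.symRicci.toQuadraticForm' = q

/-- The matrix `(i, n) ↦ Γ_{ik}^n`. -/
def rightSlice (Γ : Christoffel m) (k : Fin m) : Matrix (Fin m) (Fin m) ℝ :=
  Matrix.of fun i n => Γ i k n

theorem rightSlice_changeFrame (T : GL (Fin m) ℝ) (Γ : Christoffel m) (k : Fin m) :
    (changeFrame T Γ).rightSlice k = T.1ᵀ * (∑ b, T.1 b k • Γ.rightSlice b) * T⁻¹.1ᵀ := by
  have h := changeFrame_eq T (fun i j n => Γ j i n) k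
  have h' : (changeFrame T Γ).rightSlice k = Matrix.of (changeFrame T (fun i j n => Γ j i n) k) := by
    ext i n
    simp only [rightSlice, changeFrame, Matrix.of_apply]
    rw [Finset.sum_comm]
    exact Finset.sum_congr rfl fun b _ => Finset.sum_congr rfl fun a _ =>
      Finset.sum_congr rfl fun c _ => by ring
  rw [h', h]
  rfl

theorem ricci_eq (Γ : Christoffel m) (j k : Fin m) :
    Γ.ricci j k = (Matrix.of (Γ j) *ᵥ fun n => (Γ.rightSlice n).trace) k -
      (Matrix.of (Γ j) * Γ.rightSlice k).trace := by
  simp only [ricci, Matrix.of_apply, Finset.sum_sub_distrib, Matrix.mulVec, dotProduct,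
    Matrix.trace, Matrix.diag, Matrix.mul_apply, rightSlice, Finset.mul_sum]
  congr 1
  · rw [Finset.sum_comm]
    exact Finset.sum_congr rfl fun n _ => Finset.sum_congr rfl fun i _ => mul_comm _ _
  · rw [Finset.sum_comm]

theorem ricci_changeFrame (T : GL (Fin m) ℝ) (Γ : Christoffel m) :
    (changeFrame T Γ).ricci = T.1ᵀ * Γ.ricci * T.1 := by
  have hT : T⁻¹.1ᵀ * T.1ᵀ = 1 := by
    rw [← Matrix.transpose_mul, ← Units.val_mul]
    simp
  have hω : (fun n => ((changeFrame T Γ).rightSlice n).trace) =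
      T.1ᵀ *ᵥ fun n => (Γ.rightSlice n).trace := by
    funext n
    rw [rightSlice_changeFrame, Matrix.trace_mul_comm, ← Matrix.mul_assoc, hT, Matrix.one_mul,
      Matrix.trace_sum]
    simp [Matrix.mulVec, dotProduct, Matrix.trace_smul]
  ext j k
  rw [ricci_eq, hω, changeFrame_eq, rightSlice_changeFrame, Matrix.mulVec_mulVec]
  have h1 : T.1ᵀ * (∑ a, T.1 a j • Matrix.of (Γ a)) * T⁻¹.1ᵀ * T.1ᵀ =
      T.1ᵀ * (∑ a, T.1 a j • Matrix.of (Γ a)) := by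
    rw [Matrix.mul_assoc, hT, Matrix.mul_one]
  rw [h1, ← Matrix.mul_assoc, ← Matrix.mul_assoc, h1, Matrix.trace_mul_comm, ← Matrix.mul_assoc,
    ← Matrix.mul_assoc, hT, Matrix.one_mul]
  set w : Fin m → ℝ := fun n => (Γ.rightSlice n).trace with hw
  have h2 : ((T.1ᵀ * ∑ a, T.1 a j • Matrix.of (Γ a)) *ᵥ w) k =
      ∑ b, ∑ a, T.1 a j * (Matrix.of (Γ a) *ᵥ w) b * T.1 b k := by
    rw [← Matrix.mulVec_mulVec]
    change ∑ b, T.1ᵀ k b * ((∑ a, T.1 a j • Matrix.of (Γ a)) *ᵥ w) b = _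
    refine Finset.sum_congr rfl fun b _ => ?_
    rw [Matrix.sum_mulVec, Finset.sum_apply, Finset.mul_sum]
    refine Finset.sum_congr rfl fun a _ => ?_
    rw [Matrix.smul_mulVec, Pi.smul_apply, Matrix.transpose_apply, smul_eq_mul]
    ring
  rw [h2]
  simp only [Matrix.mul_apply, ricci_eq, Finset.sum_mul, mul_sub, sub_mul, Matrix.trace_sum,
    Matrix.mul_sum, Finset.sum_sub_distrib, Matrix.smul_mul,
    Matrix.mul_smul, Matrix.trace_smul, smul_eq_mul, Matrix.transpose_apply, ← hw]
  congr 1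
  rw [Finset.sum_comm]
  exact Finset.sum_congr rfl fun b _ => Finset.sum_congr rfl fun a _ => by ring

theorem symRicci_changeFrame (T : GL (Fin m) ℝ) (Γ : Christoffel m) :
    (changeFrame T Γ).symRicci = T.1ᵀ * Γ.symRicci * T.1 := by
  simp only [symRicci, ricci_changeFrame, Matrix.transpose_mul, Matrix.transpose_transpose,
    Matrix.mul_smul, Matrix.smul_mul, Matrix.mul_add, Matrix.add_mul, Matrix.mul_assoc]

theorem equivalent_smul (T : GL (Fin m) ℝ) (Γ : Christoffel m) :
    QuadraticMap.Equivalent (T • Γ).symRicci.toQuadraticForm' Γ.symRicci.toQuadraticForm' := by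
  refine ⟨⟨LinearMap.GeneralLinearGroup.generalLinearEquiv ℝ _
    (Matrix.GeneralLinearGroup.toLin T⁻¹), fun x => ?_⟩⟩
  change Matrix.toLinearMap₂' ℝ Γ.symRicci (T⁻¹.1 *ᵥ x) (T⁻¹.1 *ᵥ x) =
    Matrix.toLinearMap₂' ℝ (changeFrame T⁻¹ Γ).symRicci x x
  rw [symRicci_changeFrame, Matrix.toLinearMap₂'_apply', Matrix.toLinearMap₂'_apply',
    ← Matrix.mulVec_mulVec, ← Matrix.mulVec_mulVec, Matrix.mulVec_transpose,
    dotProduct_comm x, ← Matrix.dotProduct_mulVec, dotProduct_comm]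

theorem HasSignature.smul {Γ : Christoffel m} {p q : ℕ} (h : Γ.HasSignature p q)
    (T : GL (Fin m) ℝ) : (T • Γ).HasSignature p q :=
  ⟨(equivalent_smul T Γ).sigNeg_eq.trans h.1, (equivalent_smul T Γ).sigPos_eq.trans h.2⟩

/-! ### The parameter spaces -/

/-- The space `𝒵(m)` of torsion free (symmetric) Christoffel symbols. -/
def symm (m : ℕ) : Submodule ℝ (Christoffel m) where
  carrier := {Γ | ∀ i j k, Γ i j k = Γ j i k}
  zero_mem' _ _ _ := rfl
  add_mem' hΓ hΔ i j k := congrArg₂ (· + ·) (hΓ i j k) (hΔ i j k)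
  smul_mem' c _ hΓ i j k := congrArg (c * ·) (hΓ i j k)

theorem smul_mem_symm (T : GL (Fin m) ℝ) {Γ : Christoffel m} (hΓ : Γ ∈ symm m) :
    T • Γ ∈ symm m := by
  intro i j k
  change ∑ a, ∑ b, ∑ c, T⁻¹.1 a i * T⁻¹.1 b j * T⁻¹⁻¹.1 k c * Γ a b c =
    ∑ a, ∑ b, ∑ c, T⁻¹.1 a j * T⁻¹.1 b i * T⁻¹⁻¹.1 k c * Γ a b c
  rw [Finset.sum_comm]
  refine Finset.sum_congr rfl fun b _ => Finset.sum_congr rfl fun a _ =>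
    Finset.sum_congr rfl fun c _ => ?_
  rw [hΓ a b c]
  ring

/-- The general linear group acts on the torsion free Christoffel symbols. -/
instance : MulAction (GL (Fin m) ℝ) (symm m) where
  smul T Γ := ⟨T • Γ.1, smul_mem_symm T Γ.2⟩
  one_smul Γ := Subtype.ext (one_smul _ Γ.1)
  mul_smul S T Γ := Subtype.ext (mul_smul S T Γ.1)

/-- `𝒲(p, q)`, with the action of `GL⁺(m, ℝ)`. -/
def W (m p q : ℕ) : SubMulAction GL(m, ℝ)⁺ (Christoffel m) where
  carrier := {Γ | Γ.HasSignature p q}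
  smul_mem' T _ hΓ := hΓ.smul (T : GL (Fin m) ℝ)

/-- `𝒵(p, q)`, with the action of `GL⁺(m, ℝ)`. -/
def Z (m p q : ℕ) : SubMulAction GL(m, ℝ)⁺ (symm m) where
  carrier := {Γ | (Γ : Christoffel m).HasSignature p q}
  smul_mem' T _ hΓ := hΓ.smul (T : GL (Fin m) ℝ)

end Christoffel

/-- The points of an invariant set at which the isotropy group is trivial. -/
def SubMulAction.trivialIsotropy {G X : Type*} [Group G] [MulAction G X] (N : SubMulAction G X) :
    SubMulAction G X where
  carrier := {x | x ∈ N ∧ MulAction.stabilizer G x = ⊥}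
  smul_mem' g x hx := by
    refine ⟨N.smul_mem g hx.1, ?_⟩
    rw [MulAction.stabilizer_smul_eq_stabilizer_map_conj, hx.2, Subgroup.map_bot]

/-- The elements of `𝒲(p, q)` with trivial isotropy group in `GL⁺(m, ℝ)`. -/
abbrev Christoffel.WTilde (m p q : ℕ) : SubMulAction GL(m, ℝ)⁺ (Christoffel m) :=
  (Christoffel.W m p q).trivialIsotropy

/-- The elements of `𝒵(p, q)` with trivial isotropy group in `GL⁺(m, ℝ)`. -/
abbrev Christoffel.ZTilde (m p q : ℕ) : SubMulAction GL(m, ℝ)⁺ (Christoffel.symm m) :=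
  (Christoffel.Z m p q).trivialIsotropy

/-! ### Proper actions and principal bundles -/

/-- An action is proper if, whenever `x_n → x` and `g_n x_n → y`, some subsequence of `g_n`
converges. -/
def IsProperAction (G X : Type*) [TopologicalSpace G] [TopologicalSpace X] [SMul G X] : Prop :=
  ∀ (x : ℕ → X) (g : ℕ → G) (a b : X), Tendsto x atTop (𝓝 a) →
    Tendsto (fun n => g n • x n) atTop (𝓝 b) →
      ∃ (φ : ℕ → ℕ) (h : G), StrictMono φ ∧ Tendsto (fun n => g (φ n)) atTop (𝓝 h)

namespace GLPos

variable {m : ℕ}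

/-- The matrix entries of an element of `GL⁺(m, ℝ)`. -/
def entries (T : GL(m, ℝ)⁺) : Fin m → Fin m → ℝ := fun i j => (T : GL (Fin m) ℝ).1 i j

open scoped Matrix.Norms.Operator in
theorem isOpenEmbedding_entries : IsOpenEmbedding (entries (m := m)) := by
  have hopen : IsOpen ((GL(m, ℝ)⁺ : Subgroup (GL (Fin m) ℝ)) : Set (GL (Fin m) ℝ)) := by
    have : IsOpen {T : GL (Fin m) ℝ | 0 < T.1.det} :=
      isOpen_lt continuous_const (Continuous.matrix_det Units.continuous_val)
    exact this
  have h1 : IsOpenEmbedding (Units.val : GL (Fin m) ℝ → Matrix (Fin m) (Fin m) ℝ) :=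
    Units.isOpenEmbedding_val
  exact h1.comp hopen.isOpenEmbedding_subtypeVal

/-- `GL⁺(m, ℝ)` is an open subset of the vector space of all matrices. -/
instance : ChartedSpace (Fin m → Fin m → ℝ) GL(m, ℝ)⁺ :=
  isOpenEmbedding_entries.singletonChartedSpace

theorem contMDiff_entries :
    ContMDiff 𝓘(ℝ, Fin m → Fin m → ℝ) 𝓘(ℝ, Fin m → Fin m → ℝ) ∞ (entries (m := m)) :=
  contMDiff_isOpenEmbedding isOpenEmbedding_entries

theorem contDiff_det : ContDiff ℝ ∞ fun A : Fin m → Fin m → ℝ => (Matrix.of A).det := by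
  simp only [Matrix.det_apply]
  refine ContDiff.sum fun σ _ => ContDiff.const_smul _ (contDiff_prod fun i _ => ?_)
  simp only [Matrix.of_apply]
  fun_prop

theorem contDiff_adjugate (i j : Fin m) :
    ContDiff ℝ ∞ fun A : Fin m → Fin m → ℝ => (Matrix.of A).adjugate i j := by
  simp only [Matrix.adjugate_apply]
  have h : ContDiff ℝ ∞ fun A : Fin m → Fin m → ℝ =>
      (fun k l => (Matrix.of A).updateRow j (Pi.single i 1) k l : Fin m → Fin m → ℝ) := ?_
  · exact contDiff_det.comp h
  refine contDiff_pi.2 fun k => contDiff_pi.2 fun l => ?_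
  simp only [Matrix.updateRow_apply]
  split_ifs
  · exact contDiff_const
  · simp only [Matrix.of_apply]
    fun_prop

instance : LieGroup 𝓘(ℝ, Fin m → Fin m → ℝ) ∞ GL(m, ℝ)⁺ where
  toIsManifold := isOpenEmbedding_entries.isManifold_singleton
  contMDiff_mul := by
    apply ContMDiff.of_comp_isOpenEmbedding isOpenEmbedding_entries
    have h : ContDiff ℝ ∞ fun x : (Fin m → Fin m → ℝ) × (Fin m → Fin m → ℝ) =>
        (fun i j => ∑ k, x.1 i k * x.2 k j : Fin m → Fin m → ℝ) := by fun_prop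
    exact h.contMDiff.comp
      ((contMDiff_entries.comp contMDiff_fst).prodMk_space (contMDiff_entries.comp contMDiff_snd))
  contMDiff_inv := by
    apply ContMDiff.of_comp_isOpenEmbedding isOpenEmbedding_entries
    intro T
    have hT : (Matrix.of (entries T)).det ≠ 0 := (Matrix.GLPos.det_ne_zero T)
    have h : ContDiffAt ℝ ∞ (fun A : Fin m → Fin m → ℝ =>
        (fun i j => (Matrix.of A).det⁻¹ * (Matrix.of A).adjugate i j : Fin m → Fin m → ℝ))
        (entries T) :=
      contDiffAt_pi.2 fun i => contDiffAt_pi.2 fun j =>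
        (contDiff_det.contDiffAt.inv hT).mul (contDiff_adjugate i j).contDiffAt
    refine (h.contMDiffAt.comp T (contMDiff_entries T)).congr_of_eventuallyEq
      (Eventually.of_forall fun S => ?_)
    funext i j
    have : ((S⁻¹ : GL(m, ℝ)⁺) : GL (Fin m) ℝ).1 = (S : GL (Fin m) ℝ).1⁻¹ :=
      Matrix.coe_units_inv _
    change ((S⁻¹ : GL(m, ℝ)⁺) : GL (Fin m) ℝ).1 i j = _
    rw [this, Matrix.inv_def, Ring.inverse_eq_inv']
    rfl

end GLPos

section Bundle

variable (EG EN EB : Type*) [NormedAddCommGroup EG] [NormedSpace ℝ EG]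
  [NormedAddCommGroup EN] [NormedSpace ℝ EN] [NormedAddCommGroup EB] [NormedSpace ℝ EB]

/-- `π : N → B` is a smooth principal bundle for the Lie group `G`, which acts on `N`: the action
and `π` are smooth, and `B` is covered by open sets over which there is an equivariant
diffeomorphism from `N` to the product with `G` compatible with the projections to `B`. (As usual
for an action written on the left, `G` acts on the product by left multiplication.) -/
structure IsSmoothPrincipalBundle (G : Type*) {N B : Type*} [Group G] [TopologicalSpace G]
    [ChartedSpace EG G] [LieGroup 𝓘(ℝ, EG) ∞ G] [TopologicalSpace N] [ChartedSpace EN N]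
    [TopologicalSpace B] [ChartedSpace EB B] [MulAction G N] (π : N → B) : Prop where
  contMDiff_smul : ContMDiff (𝓘(ℝ, EG).prod 𝓘(ℝ, EN)) 𝓘(ℝ, EN) ∞ fun x : G × N => x.1 • x.2
  contMDiff_proj : ContMDiff 𝓘(ℝ, EN) 𝓘(ℝ, EB) ∞ π
  surjective : Function.Surjective π
  proj_eq_iff : ∀ x y, π x = π y ↔ ∃ g : G, g • x = y
  exists_trivialization : ∀ b : B, ∃ e : Bundle.Trivialization G π, b ∈ e.baseSet ∧
    ContMDiffOn 𝓘(ℝ, EN) (𝓘(ℝ, EB).prod 𝓘(ℝ, EG)) ∞ e e.source ∧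
    ContMDiffOn (𝓘(ℝ, EB).prod 𝓘(ℝ, EG)) 𝓘(ℝ, EN) ∞ e.toOpenPartialHomeomorph.symm e.target ∧
    ∀ x ∈ e.source, ∀ g : G, e (g • x) = (π x, g * (e x).2)

end Bundle

/-- The quotient of an invariant set by the group action, with the quotient topology. -/
abbrev SubMulAction.Moduli {G X : Type*} [Group G] [MulAction G X] (N : SubMulAction G X) : Type _ :=
  Quotient (MulAction.orbitRel G N)

/-- For an open invariant subset `N` of a normed space `V`: the quotient space `N / G`, with the
quotient topology, is a (Hausdorff, second countable) smooth manifold such that `N → N / G` is a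
smooth principal `G`-bundle. The smooth structure is the natural one: a function on an open subset
of `N / G` is smooth if and only if its pullback to `N` is. -/
def HasPrincipalQuotient (EG : Type*) {G V : Type*} [NormedAddCommGroup EG] [NormedSpace ℝ EG]
    [Group G] [TopologicalSpace G] [ChartedSpace EG G] [LieGroup 𝓘(ℝ, EG) ∞ G]
    [NormedAddCommGroup V] [NormedSpace ℝ V] [MulAction G V]
    (N : SubMulAction G V) (hN : IsOpen (N : Set V)) : Prop :=
  letI : ChartedSpace V N :=
    inferInstanceAs (ChartedSpace V (⟨N, hN⟩ : TopologicalSpace.Opens V))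
  T2Space N.Moduli ∧ SecondCountableTopology N.Moduli ∧
  ∃ (d : ℕ) (_ : ChartedSpace (EuclideanSpace ℝ (Fin d)) N.Moduli),
    IsManifold (𝓡 d) ∞ N.Moduli ∧
    IsSmoothPrincipalBundle EG V (EuclideanSpace ℝ (Fin d)) G
      (Quotient.mk (MulAction.orbitRel G N)) ∧
    ∀ (U : Set N.Moduli) (f : N.Moduli → ℝ), IsOpen U →
      (ContMDiffOn (𝓡 d) 𝓘(ℝ, ℝ) ∞ f U ↔
        ContMDiffOn 𝓘(ℝ, V) 𝓘(ℝ, ℝ) ∞ (fun x : N => f (Quotient.mk _ x)) (Quotient.mk _ ⁻¹' U))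

end

/-! The hypothesis of definiteness yields properness. Up to sign the symmetric Ricci tensor is a
positive definite form attached naturally to `Γ`, and `T` is an isometry from the form of `Γ` to
that of `T • Γ`. If `Γ_n` and `T_n • Γ_n` both converge to symbols with definite forms, then these
forms are eventually uniformly definite and bounded, so `T_n` and `T_n⁻¹` stay bounded and
subconverge to mutually inverse matrices (`exists_subseq_tendsto`).

Properness and trivial isotropy yield slices (`exists_localSlice`). Trivial isotropy makes the
differential of the orbit map injective, since a kernel vector would generate a one-parameter
subgroup fixing the point. The inverse function theorem then gives product coordinates, group times
complement, near the point. Properness excludes returns to a small slice by group elements far from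
the identity, so the saturation of the slice is its product with the group. Such slices prove
openness and provide charts and trivializations of the quotient. Properness also closes the orbit
relation, which gives the Hausdorff property.

Density rests on a polynomial, `frameDet`. An isotropy element preserves a nondegenerate form and
has positive determinant, hence determinant one. It preserves the covector `ω = tr Γ(x, ·)` and the
form `b = ω(Γ(x, y))`, so it fixes `v_0 = adj(b) ω` and all iterates of `v ↦ Γ(v, v)`. If the first
`m` of these vectors are independent, it is the identity. Their determinant is nonzero at the
explicit torsion free symbol `chain`, which need not have definite Ricci tensor: by the identity
theorem the polynomial then vanishes on no nonempty open set. -/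

noncomputable section

/-! ### Local slices and the smooth structure of the quotient -/

section LocalSlice

variable (EG EN EB : Type*) [NormedAddCommGroup EG] [NormedSpace ℝ EG]
  [NormedAddCommGroup EN] [NormedSpace ℝ EN] [NormedAddCommGroup EB] [NormedSpace ℝ EB]

/-- A smooth local slice for an action of `G` on `N`: a map `slice` on an open set `dom` of `EB`
such that every point of the open set `carrier` is uniquely of the form `g • slice f`, where
`g` and `f` depend smoothly on the point. -/
structure LocalSlice (G N : Type*) [Group G] [TopologicalSpace G] [ChartedSpace EG G]
    [TopologicalSpace N] [ChartedSpace EN N] [MulAction G N] where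
  /-- The domain of the slice. -/
  dom : Set EB
  /-- The union of the orbits through the slice. -/
  carrier : Set N
  /-- The parametrization of the slice. -/
  slice : EB → N
  /-- The group element which moves a point of the slice to the given point. -/
  frame : N → G
  /-- The parameter of the point of the slice in the orbit of the given point. -/
  coord : N → EB
  isOpen_dom : IsOpen dom
  isOpen_carrier : IsOpen carrier
  contMDiffOn_slice : ContMDiffOn 𝓘(ℝ, EB) 𝓘(ℝ, EN) ∞ slice dom
  contMDiffOn_frame : ContMDiffOn 𝓘(ℝ, EN) 𝓘(ℝ, EG) ∞ frame carrier
  contMDiffOn_coord : ContMDiffOn 𝓘(ℝ, EN) 𝓘(ℝ, EB) ∞ coord carrier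
  coord_mem : ∀ y ∈ carrier, coord y ∈ dom
  frame_smul_slice : ∀ y ∈ carrier, frame y • slice (coord y) = y
  smul_slice_mem : ∀ g : G, ∀ f ∈ dom, g • slice f ∈ carrier
  frame_smul : ∀ g : G, ∀ f ∈ dom, frame (g • slice f) = g
  coord_smul : ∀ g : G, ∀ f ∈ dom, coord (g • slice f) = f

namespace LocalSlice

variable {EG EN EB} {G N : Type*} [Group G] [TopologicalSpace G] [ChartedSpace EG G]
  [TopologicalSpace N] [ChartedSpace EN N] [MulAction G N] (σ : LocalSlice EG EN EB G N)

theorem smul_mem {y : N} (hy : y ∈ σ.carrier) (g : G) : g • y ∈ σ.carrier := by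
  rw [← σ.frame_smul_slice y hy, smul_smul]
  exact σ.smul_slice_mem _ _ (σ.coord_mem y hy)

theorem frame_smul_of_mem {y : N} (hy : y ∈ σ.carrier) (g : G) :
    σ.frame (g • y) = g * σ.frame y := by
  conv_lhs => rw [← σ.frame_smul_slice y hy, smul_smul]
  exact σ.frame_smul _ _ (σ.coord_mem y hy)

theorem coord_smul_of_mem {y : N} (hy : y ∈ σ.carrier) (g : G) :
    σ.coord (g • y) = σ.coord y := by
  conv_lhs => rw [← σ.frame_smul_slice y hy, smul_smul]
  exact σ.coord_smul _ _ (σ.coord_mem y hy)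

theorem slice_mem {f : EB} (hf : f ∈ σ.dom) : σ.slice f ∈ σ.carrier := by
  simpa using σ.smul_slice_mem 1 f hf

theorem coord_slice {f : EB} (hf : f ∈ σ.dom) : σ.coord (σ.slice f) = f := by
  simpa using σ.coord_smul 1 f hf

local notation "π" => Quotient.mk (MulAction.orbitRel G N)

/-- The coordinate of a point of the quotient. -/
def quotCoord (b : Quotient (MulAction.orbitRel G N)) : EB := σ.coord b.out

/-- The coordinate is constant on orbits, so the chosen representative `b.out` does not matter. -/
theorem quotCoord_mk {y : N} (hy : y ∈ σ.carrier) : σ.quotCoord (π y) = σ.coord y := by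
  have h : (MulAction.orbitRel G N) (π y).out y := Quotient.mk_out y
  rw [MulAction.orbitRel_apply] at h
  obtain ⟨g, hg : g • y = (π y).out⟩ := h
  rw [quotCoord, ← hg, σ.coord_smul_of_mem hy]

theorem mk_slice_coord {y : N} (hy : y ∈ σ.carrier) : π (σ.slice (σ.coord y)) = π y := by
  refine Quotient.sound ?_
  change (MulAction.orbitRel G N) _ _
  rw [MulAction.orbitRel_apply]
  exact ⟨(σ.frame y)⁻¹, inv_smul_eq_iff.2 (σ.frame_smul_slice y hy).symm⟩

/-- The image of a slice in the quotient. -/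
def base : Set (Quotient (MulAction.orbitRel G N)) := (fun y => π y) '' σ.carrier

theorem mk_mem_base {y : N} : π y ∈ σ.base ↔ y ∈ σ.carrier := by
  refine ⟨?_, fun h => ⟨y, h, rfl⟩⟩
  rintro ⟨z, hz, hzy⟩
  have h : (MulAction.orbitRel G N) z y := Quotient.exact hzy
  rw [MulAction.orbitRel_apply] at h
  obtain ⟨g, rfl⟩ := h
  simpa using σ.smul_mem hz g⁻¹

variable [ContinuousConstSMul G N]

theorem isOpen_base : IsOpen σ.base :=
  MulAction.isOpenQuotientMap_quotientMk.isOpenMap _ σ.isOpen_carrier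

/-- The quotient map is open, so continuity can be tested upstairs, where the function is `coord`.
-/
theorem continuousOn_quotCoord : ContinuousOn σ.quotCoord σ.base := by
  rintro _ ⟨y, hy, rfl⟩
  refine ContinuousAt.continuousWithinAt ?_
  rw [← MulAction.isOpenQuotientMap_quotientMk.continuousAt_comp_iff]
  have hc : ContinuousAt σ.coord y :=
    σ.contMDiffOn_coord.continuousOn.continuousAt (σ.isOpen_carrier.mem_nhds hy)
  refine hc.congr ?_
  filter_upwards [σ.isOpen_carrier.mem_nhds hy] with z hz
  exact (σ.quotCoord_mk hz).symm

/-- The chart of the quotient given by a slice. -/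
def chart : OpenPartialHomeomorph (Quotient (MulAction.orbitRel G N)) EB where
  toFun := σ.quotCoord
  invFun f := π (σ.slice f)
  source := σ.base
  target := σ.dom
  map_source' := by
    rintro _ ⟨y, hy, rfl⟩
    simpa only [σ.quotCoord_mk hy] using σ.coord_mem y hy
  map_target' f hf := σ.mk_mem_base.2 (σ.slice_mem hf)
  left_inv' := by
    rintro _ ⟨y, hy, rfl⟩
    simpa only [σ.quotCoord_mk hy] using σ.mk_slice_coord hy
  right_inv' f hf := by rw [σ.quotCoord_mk (σ.slice_mem hf), σ.coord_slice hf]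
  open_source := σ.isOpen_base
  open_target := σ.isOpen_dom
  continuousOn_toFun := σ.continuousOn_quotCoord
  continuousOn_invFun := continuous_quotient_mk'.comp_continuousOn σ.contMDiffOn_slice.continuousOn

/-- A change of charts is `τ.coord ∘ σ.slice`, a composite of smooth maps that never mentions the
quotient. -/
theorem contDiffOn_transition (τ : LocalSlice EG EN EB G N) :
    ContDiffOn ℝ ∞ (σ.chart.symm.trans τ.chart) (σ.chart.symm.trans τ.chart).source := by
  rw [← contMDiffOn_iff_contDiffOn]
  have hs : ∀ f ∈ (σ.chart.symm.trans τ.chart).source, f ∈ σ.dom ∧ σ.slice f ∈ τ.carrier := by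
    intro f hf
    rw [OpenPartialHomeomorph.trans_source] at hf
    exact ⟨hf.1, τ.mk_mem_base.1 hf.2⟩
  refine ((τ.contMDiffOn_coord.comp (σ.contMDiffOn_slice.mono fun f hf => (hs f hf).1)
    fun f hf => (hs f hf).2)).congr fun f hf => ?_
  exact τ.quotCoord_mk (hs f hf).2

variable (s : N → LocalSlice EG EN EB G N) (hs : ∀ x, x ∈ (s x).carrier)

/-- The atlas of the quotient given by slices through all points. -/
abbrev chartedSpace : ChartedSpace EB (Quotient (MulAction.orbitRel G N)) where
  atlas := Set.range fun x => (s x).chart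
  chartAt b := (s b.out).chart
  mem_chart_source b := by
    have := (s b.out).mk_mem_base.2 (hs b.out)
    rwa [Quotient.out_eq] at this
  chart_mem_atlas b := ⟨b.out, rfl⟩

theorem isManifold :
    letI := chartedSpace s hs
    IsManifold 𝓘(ℝ, EB) ∞ (Quotient (MulAction.orbitRel G N)) := by
  let := chartedSpace s hs
  refine isManifold_of_contDiffOn _ _ _ ?_
  rintro _ _ ⟨x, rfl⟩ ⟨y, rfl⟩
  simpa using (s x).contDiffOn_transition (s y)

theorem contMDiffOn_quotCoord (x : N) :
    letI := chartedSpace s hs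
    ContMDiffOn 𝓘(ℝ, EB) 𝓘(ℝ, EB) ∞ (s x).quotCoord (s x).base := by
  let := chartedSpace s hs
  have := isManifold s hs
  exact contMDiffOn_of_mem_maximalAtlas (e := (s x).chart)
    (IsManifold.subset_maximalAtlas ⟨x, rfl⟩)

theorem contMDiff_mk :
    letI := chartedSpace s hs
    ContMDiff 𝓘(ℝ, EN) 𝓘(ℝ, EB) ∞ (Quotient.mk (MulAction.orbitRel G N)) := by
  let := chartedSpace s hs
  have := isManifold s hs
  intro x
  have h : ContMDiffOn 𝓘(ℝ, EB) 𝓘(ℝ, EB) ∞ (s x).chart.symm (s x).dom :=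
    contMDiffOn_symm_of_mem_maximalAtlas (e := (s x).chart)
      (IsManifold.subset_maximalAtlas ⟨x, rfl⟩)
  have h' := (h.comp (s x).contMDiffOn_coord (s x).coord_mem).contMDiffAt
    ((s x).isOpen_carrier.mem_nhds (hs x))
  refine h'.congr_of_eventuallyEq ?_
  filter_upwards [(s x).isOpen_carrier.mem_nhds (hs x)] with y hy
  exact ((s x).mk_slice_coord hy).symm

/-- Slices are smooth local sections: near `π x` the function `f` equals `(f ∘ π) ∘ slice ∘
quotCoord`, so smoothness descends from the pullback. -/
theorem contMDiffOn_iff_comp_mk {F : Type*} [NormedAddCommGroup F] [NormedSpace ℝ F]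
    (U : Set (Quotient (MulAction.orbitRel G N))) (hU : IsOpen U)
    (f : Quotient (MulAction.orbitRel G N) → F) :
    letI := chartedSpace s hs
    ContMDiffOn 𝓘(ℝ, EB) 𝓘(ℝ, F) ∞ f U ↔
      ContMDiffOn 𝓘(ℝ, EN) 𝓘(ℝ, F) ∞ (fun x : N => f (Quotient.mk _ x))
        (Quotient.mk _ ⁻¹' U) := by
  let := chartedSpace s hs
  refine ⟨fun h => h.comp (contMDiff_mk s hs).contMDiffOn fun _ hx => hx, fun h b hb => ?_⟩
  refine ContMDiffAt.contMDiffWithinAt ?_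
  induction b using Quotient.inductionOn with | _ x
  have hx := hs x
  have hU' : IsOpen (Quotient.mk (MulAction.orbitRel G N) ⁻¹' U) :=
    hU.preimage continuous_quotient_mk'
  have hy : π ((s x).slice ((s x).coord x)) ∈ U := by rwa [(s x).mk_slice_coord hx]
  have h1 : ContMDiffAt 𝓘(ℝ, EN) 𝓘(ℝ, F) ∞ (fun x : N => f (Quotient.mk _ x))
      ((s x).slice ((s x).quotCoord (π x))) := by
    rw [(s x).quotCoord_mk hx]
    exact h.contMDiffAt (hU'.mem_nhds hy)
  have h2 : ContMDiffAt 𝓘(ℝ, EB) 𝓘(ℝ, EN) ∞ (s x).slice ((s x).quotCoord (π x)) := by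
    rw [(s x).quotCoord_mk hx]
    exact (s x).contMDiffOn_slice.contMDiffAt
      ((s x).isOpen_dom.mem_nhds ((s x).coord_mem x hx))
  have h3 : ContMDiffAt 𝓘(ℝ, EB) 𝓘(ℝ, EB) ∞ (s x).quotCoord (π x) :=
    (contMDiffOn_quotCoord s hs x).contMDiffAt
      ((s x).isOpen_base.mem_nhds ((s x).mk_mem_base.2 hx))
  refine ((h1.comp _ h2).comp _ h3).congr_of_eventuallyEq ?_
  filter_upwards [(s x).isOpen_base.mem_nhds ((s x).mk_mem_base.2 hx)] with b hb
  obtain ⟨y, hy, rfl⟩ := hb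
  simp only [Function.comp_apply, (s x).quotCoord_mk hy, (s x).mk_slice_coord hy]

variable [ContinuousSMul G N]

/-- The local trivialization of the quotient map given by a slice. -/
def trivialization : Bundle.Trivialization G (Quotient.mk (MulAction.orbitRel G N)) where
  toFun y := (π y, σ.frame y)
  invFun x := x.2 • σ.slice (σ.quotCoord x.1)
  source := σ.carrier
  target := σ.base ×ˢ Set.univ
  map_source' y hy := ⟨σ.mk_mem_base.2 hy, Set.mem_univ _⟩
  map_target' := by
    rintro ⟨_, g⟩ ⟨⟨y, hy, rfl⟩, -⟩
    simp only [σ.quotCoord_mk hy]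
    exact σ.smul_slice_mem g _ (σ.coord_mem y hy)
  left_inv' y hy := by simp only [σ.quotCoord_mk hy, σ.frame_smul_slice y hy]
  right_inv' := by
    rintro ⟨_, g⟩ ⟨⟨y, hy, rfl⟩, -⟩
    simp only [σ.quotCoord_mk hy, σ.frame_smul g _ (σ.coord_mem y hy)]
    congr 1
    rw [← σ.mk_slice_coord hy]
    refine Quotient.sound ?_
    change (MulAction.orbitRel G N) _ _
    rw [MulAction.orbitRel_apply]
    exact ⟨g, rfl⟩
  open_source := σ.isOpen_carrier
  open_target := σ.isOpen_base.prod isOpen_univ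
  continuousOn_toFun := continuous_quotient_mk'.continuousOn.prodMk
    σ.contMDiffOn_frame.continuousOn
  continuousOn_invFun := by
    refine continuous_snd.continuousOn.smul (σ.contMDiffOn_slice.continuousOn.comp
      (σ.continuousOn_quotCoord.comp continuous_fst.continuousOn fun x hx => hx.1) ?_)
    rintro ⟨_, g⟩ ⟨⟨y, hy, rfl⟩, -⟩
    simpa only [σ.quotCoord_mk hy] using σ.coord_mem y hy
  baseSet := σ.base
  open_baseSet := σ.isOpen_base
  source_eq := by
    ext y
    exact σ.mk_mem_base.symm
  target_eq := rfl
  proj_toFun _ _ := rfl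

theorem isSmoothPrincipalBundle [LieGroup 𝓘(ℝ, EG) ∞ G]
    (hsmul : ContMDiff (𝓘(ℝ, EG).prod 𝓘(ℝ, EN)) 𝓘(ℝ, EN) ∞ fun x : G × N => x.1 • x.2) :
    letI := chartedSpace s hs
    IsSmoothPrincipalBundle EG EN EB G (Quotient.mk (MulAction.orbitRel G N)) := by
  let := chartedSpace s hs
  refine ⟨hsmul, contMDiff_mk s hs, Quotient.mk_surjective, fun x y => ?_, fun b => ?_⟩
  · rw [eq_comm, Quotient.eq, MulAction.orbitRel_apply]
    rfl
  induction b using Quotient.inductionOn with | _ x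
  refine ⟨(s x).trivialization, (s x).mk_mem_base.2 (hs x), ?_, ?_, ?_⟩
  · exact (contMDiff_mk s hs).contMDiffOn.prodMk (s x).contMDiffOn_frame
  · refine hsmul.comp_contMDiffOn (contMDiff_snd.contMDiffOn.prodMk
      ((s x).contMDiffOn_slice.comp ((contMDiffOn_quotCoord s hs x).comp
        contMDiff_fst.contMDiffOn fun y hy => hy.1) ?_))
    rintro ⟨_, g⟩ ⟨⟨y, hy, rfl⟩, -⟩
    change (s x).quotCoord (π y) ∈ (s x).dom
    rw [(s x).quotCoord_mk hy]
    exact (s x).coord_mem y hy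
  · intro y hy g
    refine Prod.ext (Quotient.sound ?_) ((s x).frame_smul_of_mem hy g)
    change (MulAction.orbitRel G N) _ _
    rw [MulAction.orbitRel_apply]
    exact ⟨g, rfl⟩

end LocalSlice

end LocalSlice

/-! ### One-parameter subgroups of `GL⁺(m, ℝ)` and infinitesimally free actions -/

namespace GLPos

variable {m : ℕ}

/-- A left inverse of `entries`. -/
def ofEntries : (Fin m → Fin m → ℝ) → GL(m, ℝ)⁺ :=
  (isOpenEmbedding_entries.toOpenPartialHomeomorph entries).symm

@[simp]
theorem ofEntries_entries (T : GL(m, ℝ)⁺) : ofEntries (entries T) = T :=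
  isOpenEmbedding_entries.toOpenPartialHomeomorph_left_inv

theorem contMDiffOn_ofEntries :
    ContMDiffOn 𝓘(ℝ, Fin m → Fin m → ℝ) 𝓘(ℝ, Fin m → Fin m → ℝ) ∞ (ofEntries (m := m))
      (Set.range entries) :=
  contMDiffOn_isOpenEmbedding_symm isOpenEmbedding_entries

theorem isOpen_range_entries : IsOpen (Set.range (entries (m := m))) :=
  isOpenEmbedding_entries.isOpen_range

-- The curve is `t ↦ exp (t ξ)`. Its determinant is positive because each value is the square of the
-- value at `t / 2`.
open scoped Matrix.Norms.Operator in
theorem exists_oneParameter (ξ : Fin m → Fin m → ℝ) : ∃ c : ℝ → GL(m, ℝ)⁺,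
    c 0 = 1 ∧ (∀ s t, c (s + t) = c s * c t) ∧ HasDerivAt (fun t => entries (c t)) ξ 0 := by
  let A : Matrix (Fin m) (Fin m) ℝ := Matrix.of ξ
  have hadd : ∀ s t : ℝ, NormedSpace.exp ((s + t) • A) =
      NormedSpace.exp (s • A) * NormedSpace.exp (t • A) := fun s t => by
    rw [add_smul, Matrix.exp_add_of_commute]
    exact ((Commute.refl A).smul_left s).smul_right t
  have hinv : ∀ t : ℝ, NormedSpace.exp (t • A) * NormedSpace.exp (-t • A) = 1 := fun t => by
    rw [← hadd]
    simp
  let u : ℝ → GL (Fin m) ℝ := fun t =>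
    ⟨NormedSpace.exp (t • A), NormedSpace.exp (-t • A), hinv t, by simpa using hinv (-t)⟩
  have hu : ∀ s t, u (s + t) = u s * u t := fun s t => Units.ext (hadd s t)
  have hpos : ∀ t, 0 < (u t).1.det := fun t => by
    have h : u t = u (t / 2) * u (t / 2) := by rw [← hu, add_halves]
    rw [h, Units.val_mul, Matrix.det_mul]
    have := (Matrix.isUnits_det_units (u (t / 2))).ne_zero
    exact mul_self_pos.2 this
  refine ⟨fun t => ⟨u t, hpos t⟩, ?_, fun s t => Subtype.ext (hu s t), ?_⟩
  · refine Subtype.ext (Units.ext ?_)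
    simp [u]
  · have h := hasDerivAt_exp_smul_const A (0 : ℝ)
    rw [zero_smul, NormedSpace.exp_zero, one_mul] at h
    refine hasDerivAt_pi.2 fun i => hasDerivAt_pi.2 fun j => ?_
    let ev : Matrix (Fin m) (Fin m) ℝ →L[ℝ] ℝ :=
      LinearMap.toContinuousLinearMap (Matrix.entryLinearMap ℝ ℝ i j)
    exact ev.hasFDerivAt.comp_hasDerivAt (0 : ℝ) h

end GLPos

section SmoothAction

open GLPos

variable {m : ℕ} {V : Type*} [NormedAddCommGroup V] [NormedSpace ℝ V] [MulAction GL(m, ℝ)⁺ V]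

/-- The smoothness of an action of `GL⁺(m, ℝ)` on a normed space. -/
def IsSmoothAction (m : ℕ) (V : Type*) [NormedAddCommGroup V] [NormedSpace ℝ V]
    [MulAction GL(m, ℝ)⁺ V] : Prop :=
  ContMDiff (𝓘(ℝ, Fin m → Fin m → ℝ).prod 𝓘(ℝ, V)) 𝓘(ℝ, V) ∞
    fun x : GL(m, ℝ)⁺ × V => x.1 • x.2

namespace IsSmoothAction

theorem continuousSMul (h : IsSmoothAction m V) : ContinuousSMul GL(m, ℝ)⁺ V :=
  ⟨h.continuous⟩

theorem contDiff_const_smul (h : IsSmoothAction m V) (g : GL(m, ℝ)⁺) :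
    ContDiff ℝ ∞ fun x : V => g • x := by
  rw [← contMDiff_iff_contDiff]
  exact ContMDiff.comp (g := fun x : GL(m, ℝ)⁺ × V => x.1 • x.2) h
    (contMDiff_const.prodMk contMDiff_id)

theorem contDiffOn_ofEntries_smul (h : IsSmoothAction m V) :
    ContDiffOn ℝ ∞ (fun p : (Fin m → Fin m → ℝ) × V => ofEntries p.1 • p.2)
      (Set.range entries ×ˢ Set.univ) := by
  rw [← contMDiffOn_iff_contDiffOn]
  refine ContMDiff.comp_contMDiffOn h (ContMDiffOn.prodMk
    (contMDiffOn_ofEntries.comp contDiff_fst.contMDiff.contMDiffOn fun p hp => hp.1)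
    contDiff_snd.contMDiff.contMDiffOn)

theorem differentiableAt_orbit (h : IsSmoothAction m V) (x : V) :
    DifferentiableAt ℝ (fun A => ofEntries A • x) (entries (1 : GL(m, ℝ)⁺)) := by
  have h1 := h.contDiffOn_ofEntries_smul.contDiffAt (x := (entries 1, x))
    ((isOpen_range_entries.prod isOpen_univ).mem_nhds ⟨⟨1, rfl⟩, trivial⟩)
  exact (h1.differentiableAt (by simp)).comp (entries (1 : GL(m, ℝ)⁺))
    (by fun_prop : DifferentiableAt ℝ (fun A => (A, x)) _)

/-- For `ξ` in the kernel, the curve `c t • x` along the one-parameter subgroup of `ξ` has zero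
derivative at `0`, hence everywhere by the group law. So `c` stays in the trivial stabilizer and `ξ
= 0`. -/
theorem injective_fderiv_orbit (h : IsSmoothAction m V) {x : V}
    (hx : MulAction.stabilizer GL(m, ℝ)⁺ x = ⊥) :
    Function.Injective (fderiv ℝ (fun A => ofEntries A • x) (entries (1 : GL(m, ℝ)⁺))) := by
  refine (injective_iff_map_eq_zero _).2 fun ξ hξ => ?_
  obtain ⟨c, hc0, hadd, hc⟩ := exists_oneParameter ξ
  have h0 : HasDerivAt (fun t => c t • x) 0 0 := by
    have h1 := (h.differentiableAt_orbit x).hasFDerivAt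
    rw [← hc0] at h1 hξ
    have h2 := h1.comp_hasDerivAt (0 : ℝ) hc
    rw [hξ] at h2
    simpa [Function.comp_def] using h2
  have ht : ∀ t, HasDerivAt (fun t => c t • x) 0 t := by
    intro t
    have h1 := (((h.contDiff_const_smul (c t)).differentiable (by simp)).differentiableAt
      (x := c 0 • x)).hasFDerivAt.comp_hasDerivAt (0 : ℝ) h0
    rw [map_zero] at h1
    have h2 : HasDerivAt (fun s => c (t + s) • x) 0 0 := by
      simpa only [hadd, mul_smul, Function.comp_def] using h1
    have h3 := HasDerivAt.comp_add_const (x := t) (a := -t)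
      (f := fun s => c (t + s) • x) (f' := 0) (by simpa using h2)
    simpa using h3
  have hconst : ∀ t, c t = 1 := by
    intro t
    have h1 := is_const_of_deriv_eq_zero (fun t => (ht t).differentiableAt)
      (fun t => (ht t).deriv) t 0
    simp only [hc0, one_smul] at h1
    rw [← Subgroup.mem_bot, ← hx]
    exact h1
  simp only [hconst] at hc
  exact hc.unique (hasDerivAt_const _ _)

end IsSmoothAction

/-! ### The slice theorem -/

/-- The map `ι` parametrizes a linear complement of the range of `D`. The truncated subtraction is a
true one because `D` is injective. -/
theorem exists_complement_equiv {E F : Type*} [NormedAddCommGroup E] [NormedSpace ℝ E]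
    [FiniteDimensional ℝ E] [NormedAddCommGroup F] [NormedSpace ℝ F] [FiniteDimensional ℝ F]
    (D : E →L[ℝ] F) (hD : Function.Injective D) :
    ∃ (ι : EuclideanSpace ℝ (Fin (Module.finrank ℝ F - Module.finrank ℝ E)) →L[ℝ] F)
      (L : (E × EuclideanSpace ℝ (Fin (Module.finrank ℝ F - Module.finrank ℝ E))) ≃L[ℝ] F),
      (L : _ →L[ℝ] F) = D.coprod ι := by
  obtain ⟨C, hC⟩ := Submodule.exists_isCompl (LinearMap.range (D : E →ₗ[ℝ] F))
  have hdim : Module.finrank ℝ (EuclideanSpace ℝ (Fin (Module.finrank ℝ F - Module.finrank ℝ E))) =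
      Module.finrank ℝ C := by
    have h1 := Submodule.finrank_add_eq_of_isCompl hC
    rw [LinearMap.finrank_range_of_inj hD] at h1
    rw [finrank_euclideanSpace_fin]
    lia
  let e := LinearEquiv.ofFinrankEq _ _ hdim
  let ι := C.subtype ∘ₗ e.toLinearMap
  have hι : LinearMap.range ι = C := by
    rw [LinearMap.range_comp, LinearEquiv.range, Submodule.map_top, Submodule.range_subtype]
  have hinj : Function.Injective ι := C.injective_subtype.comp e.injective
  have hbij : Function.Bijective ((D : E →ₗ[ℝ] F).coprod ι) := by
    constructor
    · rw [← LinearMap.ker_eq_bot, LinearMap.ker_coprod_of_disjoint_range _ _ (hι ▸ hC.disjoint),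
        LinearMap.ker_eq_bot.2 hinj, LinearMap.ker_eq_bot.2 hD, Submodule.prod_bot]
    · rw [← LinearMap.range_eq_top, LinearMap.range_coprod, hι, hC.sup_eq_top]
  refine ⟨LinearMap.toContinuousLinearMap ι,
    (LinearEquiv.ofBijective _ hbij).toContinuousLinearEquiv, ?_⟩
  ext x <;> simp

namespace IsSmoothAction

variable [FiniteDimensional ℝ V]

/-- Near a point with trivial isotropy group, the points of a complement of the tangent space of
the orbit and the elements of the group near the identity are smooth coordinates. -/
theorem exists_local_product (h : IsSmoothAction m V) {x : V}
    (hx : MulAction.stabilizer GL(m, ℝ)⁺ x = ⊥) :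
    ∃ (ι : EuclideanSpace ℝ (Fin (Module.finrank ℝ V - Module.finrank ℝ (Fin m → Fin m → ℝ)))
        →L[ℝ] V)
      (Ψ : OpenPartialHomeomorph ((Fin m → Fin m → ℝ) × EuclideanSpace ℝ
        (Fin (Module.finrank ℝ V - Module.finrank ℝ (Fin m → Fin m → ℝ)))) V),
      (entries 1, 0) ∈ Ψ.source ∧ (∀ p, Ψ p = ofEntries p.1 • (x + ι p.2)) ∧
      (∀ p ∈ Ψ.source, p.1 ∈ Set.range entries) ∧ ContDiffOn ℝ ∞ Ψ.symm Ψ.target := by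
  obtain ⟨ι, L, hL⟩ := exists_complement_equiv _ (h.injective_fderiv_orbit hx)
  let E := EuclideanSpace ℝ (Fin (Module.finrank ℝ V - Module.finrank ℝ (Fin m → Fin m → ℝ)))
  let O : Set ((Fin m → Fin m → ℝ) × E) := Set.range entries ×ˢ Set.univ
  have hO : IsOpen O := isOpen_range_entries.prod isOpen_univ
  let Φ : (Fin m → Fin m → ℝ) × E → V := fun p => ofEntries p.1 • (x + ι p.2)
  have hΦ : ContDiffOn ℝ ∞ Φ O := by
    have h1 : ContDiff ℝ ∞ fun p : (Fin m → Fin m → ℝ) × E => (p.1, x + ι p.2) := by fun_prop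
    exact h.contDiffOn_ofEntries_smul.comp h1.contDiffOn fun p hp => ⟨hp.1, trivial⟩
  have hmem : ((entries 1, 0) : (Fin m → Fin m → ℝ) × E) ∈ O := ⟨⟨1, rfl⟩, trivial⟩
  have hat := hΦ.contDiffAt (hO.mem_nhds hmem)
  -- The partial derivatives are the differential of the orbit map and `ι`, which together form the
  -- isomorphism `L`.
  have hderiv : HasFDerivAt Φ (L : _ →L[ℝ] V) (entries 1, 0) := by
    have h1 := (hat.differentiableAt (by simp)).hasFDerivAt
    have hinl := (HasFDerivAt.comp (f := fun A => (A, (0 : E))) (entries (1 : GL(m, ℝ)⁺)) h1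
      (hasFDerivAt_prodMk_left _ _)).fderiv
    have hinr := (HasFDerivAt.comp (f := fun f : E => (entries (1 : GL(m, ℝ)⁺), f)) 0 h1
      (hasFDerivAt_prodMk_right _ _)).fderiv
    have e1 : Φ ∘ (fun A => (A, 0)) = fun A => ofEntries A • x := by
      funext A
      simp [Φ]
    have e2 : Φ ∘ (fun f => (entries 1, f)) = fun f => x + ι f := by
      funext f
      simp [Φ]
    rw [e1] at hinl
    rw [e2, fderiv_const_add, ContinuousLinearMap.fderiv] at hinr
    convert! h1
    rw [hL, hinl, hinr]
    ext p
    · simp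
    · simp only [ContinuousLinearMap.coprod_comp_inr]
      rfl
  let Ψ := hat.toOpenPartialHomeomorph Φ hderiv (by simp)
  have hΨ : ⇑Ψ = Φ := rfl
  -- On `S` the differential is invertible at every point, which makes the inverse smooth on the
  -- whole target and not only at the base point.
  let S : Set ((Fin m → Fin m → ℝ) × E) := O ∩ fderiv ℝ Φ ⁻¹'
    Set.range ((↑) : (((Fin m → Fin m → ℝ) × E) ≃L[ℝ] V) → _ →L[ℝ] V)
  have hS : IsOpen S := (hΦ.continuousOn_fderiv_of_isOpen hO (by simp)).isOpen_inter_preimage hO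
    ContinuousLinearEquiv.isOpen
  refine ⟨ι, Ψ.restrOpen S hS, ?_, fun p => rfl, fun p hp => hp.2.1.1, ?_⟩
  · exact ⟨hat.mem_toOpenPartialHomeomorph_source hderiv (by simp), hmem, L, hderiv.fderiv.symm⟩
  · intro y hy
    refine ContDiffAt.contDiffWithinAt ?_
    obtain ⟨hpO, L', hL'⟩ := ((Ψ.restrOpen S hS).map_target hy).2
    refine (Ψ.restrOpen S hS).contDiffAt_symm hy (f₀' := L') ?_ (hΦ.contDiffAt (hO.mem_nhds hpO))
    rw [hL']
    exact ((hΦ.contDiffAt (hO.mem_nhds hpO)).differentiableAt (by simp)).hasFDerivAt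

end IsSmoothAction

end SmoothAction

/-! ### Proper actions: slices and quotients -/

section ProperAction

open GLPos

variable {m : ℕ} {V : Type*} [NormedAddCommGroup V] [NormedSpace ℝ V] [MulAction GL(m, ℝ)⁺ V]

namespace IsSmoothAction

/-- A proper action moves small pieces of a local slice at a point with trivial isotropy group off
themselves. -/
theorem exists_ball_isolated {E : Type*} [NormedAddCommGroup E] [NormedSpace ℝ E]
    (h : IsSmoothAction m V) {W : SubMulAction GL(m, ℝ)⁺ V} (hW : IsOpen (W : Set V))
    (hprop : IsProperAction GL(m, ℝ)⁺ W) {x : V} (hx : x ∈ W.trivialIsotropy) (ι : E →L[ℝ] V)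
    {S : Set ((Fin m → Fin m → ℝ) × E)} (hS : IsOpen S) (hmem : (entries 1, 0) ∈ S)
    (hinj : Set.InjOn (fun p : (Fin m → Fin m → ℝ) × E => ofEntries p.1 • (x + ι p.2)) S) :
    ∃ ε > 0, ∀ f ∈ Metric.ball (0 : E) ε, (entries 1, f) ∈ S ∧ x + ι f ∈ W ∧
      ∀ f' ∈ Metric.ball (0 : E) ε, ∀ g : GL(m, ℝ)⁺, g • (x + ι f) = x + ι f' → g = 1 ∧ f = f' := by
  have := h.continuousSMul
  have hcont : Continuous fun f : E => x + ι f := by fun_prop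
  have hev : ∀ᶠ f in 𝓝 (0 : E), ((entries 1, f) : (Fin m → Fin m → ℝ) × E) ∈ S ∧ x + ι f ∈ W := by
    refine ((Continuous.prodMk_right (entries 1)).continuousAt.eventually (hS.mem_nhds hmem)).and
      (hcont.continuousAt.eventually (hW.mem_nhds ?_))
    simpa using hx.1
  obtain ⟨δ, hδ, hball⟩ := Metric.eventually_nhds_iff_ball.1 hev
  -- Otherwise there are returns `g_n • (x + ι f_n) = x + ι f'_n` with `f_n, f'_n → 0`. By
  -- properness a subsequence of `g_n` converges, to an element fixing `x`, hence to `1`. Eventually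
  -- `(g_n, f_n)` lies in `S`, and injectivity against `(1, f'_n)` is a contradiction.
  by_contra! hcon
  have hpos : ∀ n : ℕ, 0 < min δ (1 / ((n : ℝ) + 1)) := fun n =>
    lt_min hδ Nat.one_div_pos_of_nat
  have hbad : ∀ n : ℕ, ∃ f f' : E, ∃ g : GL(m, ℝ)⁺, f ∈ Metric.ball 0 (min δ (1 / ((n : ℝ) + 1))) ∧
      f' ∈ Metric.ball 0 (min δ (1 / ((n : ℝ) + 1))) ∧ g • (x + ι f) = x + ι f' ∧
      (g = 1 → f ≠ f') := by
    intro n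
    obtain ⟨f, hf, hf'⟩ := hcon _ (hpos n)
    have hfδ := hball f (Metric.ball_subset_ball (min_le_left _ _) hf)
    obtain ⟨f', hf'b, g, hg, hne⟩ := hf' hfδ.1 hfδ.2
    exact ⟨f, f', g, hf, hf'b, hg, hne⟩
  choose f f' g hf hf' hg hne using hbad
  have htend : ∀ u : ℕ → E, (∀ n : ℕ, u n ∈ Metric.ball 0 (min δ (1 / ((n : ℝ) + 1)))) →
      Tendsto u atTop (𝓝 0) := by
    intro u hu
    refine squeeze_zero_norm (fun n => ?_) tendsto_one_div_add_atTop_nhds_zero_nat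
    exact ((mem_ball_zero_iff.1 (hu n)).trans_le (min_le_right _ _)).le
  have hWm : ∀ u : ℕ → E, (∀ n : ℕ, u n ∈ Metric.ball 0 (min δ (1 / ((n : ℝ) + 1)))) →
      ∀ n, x + ι (u n) ∈ W := fun u hu n =>
    (hball _ (Metric.ball_subset_ball (min_le_left _ _) (hu n))).2
  have hlim : ∀ u : ℕ → E, Tendsto u atTop (𝓝 0) → Tendsto (fun n => x + ι (u n)) atTop (𝓝 x) := by
    intro u hu
    simpa [Function.comp_def] using (hcont.tendsto 0).comp hu
  obtain ⟨φ, k, hφ, hk⟩ := hprop (fun n => ⟨x + ι (f n), hWm f hf n⟩) g ⟨x, hx.1⟩ ⟨x, hx.1⟩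
    (tendsto_subtype_rng.2 (hlim f (htend f hf))) (tendsto_subtype_rng.2 (by
      refine (hlim f' (htend f' hf')).congr fun n => ?_
      exact (hg n).symm))
  have hfφ := (htend f hf).comp hφ.tendsto_atTop
  have hf'φ := (htend f' hf').comp hφ.tendsto_atTop
  have hk1 : k = 1 := by
    have h1 : Tendsto (fun n => g (φ n) • (x + ι (f (φ n)))) atTop (𝓝 (k • x)) :=
      hk.smul (hlim _ hfφ)
    have h2 : Tendsto (fun n => g (φ n) • (x + ι (f (φ n)))) atTop (𝓝 x) :=
      (hlim _ hf'φ).congr fun n => (hg (φ n)).symm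
    rw [← Subgroup.mem_bot, ← hx.2]
    exact tendsto_nhds_unique h1 h2
  rw [hk1] at hk
  have hp : ∀ᶠ n in atTop, ((entries (g (φ n)), f (φ n)) : (Fin m → Fin m → ℝ) × E) ∈ S :=
    (((isOpenEmbedding_entries.continuous.tendsto 1).comp hk).prodMk_nhds hfφ).eventually
      (hS.mem_nhds hmem)
  obtain ⟨n, hn⟩ := hp.exists
  have hn' := (hball _ (Metric.ball_subset_ball (min_le_left _ _) (hf' (φ n)))).1
  have heq := hinj hn hn' (by simpa using hg (φ n))
  rw [Prod.mk.injEq] at heq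
  exact hne (φ n) (isOpenEmbedding_entries.injective heq.1) heq.2

variable [FiniteDimensional ℝ V]

/-- The carrier is the saturation of a small affine disc `x + ι f`. Isolation of the disc makes the
decomposition of its points unique; smoothness holds near the disc by the inverse function theorem
and is carried elsewhere by translation. -/
theorem exists_localSlice (h : IsSmoothAction m V) {W : SubMulAction GL(m, ℝ)⁺ V}
    (hW : IsOpen (W : Set V)) (hprop : IsProperAction GL(m, ℝ)⁺ W) {x : V}
    (hx : x ∈ W.trivialIsotropy) :
    ∃ σ : LocalSlice (Fin m → Fin m → ℝ) V (EuclideanSpace ℝ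
        (Fin (Module.finrank ℝ V - Module.finrank ℝ (Fin m → Fin m → ℝ)))) GL(m, ℝ)⁺ V,
      x ∈ σ.carrier ∧ σ.carrier ⊆ W.trivialIsotropy := by
  classical
  have := h.continuousSMul
  obtain ⟨ι, Ψ, hΨ1, hΨ, hΨO, hΨs⟩ := h.exists_local_product hx.2
  set E := EuclideanSpace ℝ (Fin (Module.finrank ℝ V - Module.finrank ℝ (Fin m → Fin m → ℝ)))
  obtain ⟨ε, hε, hball⟩ := h.exists_ball_isolated hW hprop hx ι Ψ.open_source hΨ1
    (Ψ.injOn.congr fun p _ => hΨ p)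
  let Ω : Set E := Metric.ball 0 ε
  let s : E → V := fun f => x + ι f
  have hs : ContDiff ℝ ∞ s := by fun_prop
  have huniq : ∀ g g' : GL(m, ℝ)⁺, ∀ f ∈ Ω, ∀ f' ∈ Ω, g • s f = g' • s f' → g = g' ∧ f = f' := by
    intro g g' f hf f' hf' hgg
    have h1 := (hball f hf).2.2 f' hf' (g'⁻¹ * g) (by
      rw [mul_smul, inv_smul_eq_iff]
      exact hgg)
    exact ⟨(inv_mul_eq_one.1 h1.1).symm, h1.2⟩
  let U : Set V := {y | ∃ p : GL(m, ℝ)⁺ × E, p.2 ∈ Ω ∧ p.1 • s p.2 = y}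
  -- The choice is harmless since `huniq` makes the pair unique; the value `(1, 0)` off `U` plays no
  -- role.
  let pr : V → GL(m, ℝ)⁺ × E := fun y => if hy : y ∈ U then hy.choose else (1, 0)
  have hpr : ∀ y ∈ U, (pr y).2 ∈ Ω ∧ (pr y).1 • s (pr y).2 = y := by
    intro y hy
    simp only [pr, dif_pos hy]
    exact hy.choose_spec
  have hpr' : ∀ g : GL(m, ℝ)⁺, ∀ f ∈ Ω, pr (g • s f) = (g, f) := by
    intro g f hf
    have h1 := hpr (g • s f) ⟨(g, f), hf, rfl⟩
    obtain ⟨h2, h3⟩ := huniq _ _ _ h1.1 f hf h1.2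
    exact Prod.ext h2 h3
  -- Near the disc `pr` coincides with the local inverse `Ψ.symm`, so it inherits its smoothness.
  have hlocal : ∀ f ∈ Ω, ∀ᶠ z in 𝓝 (s f), z ∈ Ψ.target ∧ z ∈ U ∧
      pr z = (ofEntries (Ψ.symm z).1, (Ψ.symm z).2) := by
    intro f hf
    have hsf : Ψ (entries 1, f) = s f := by
      rw [hΨ]
      simp [s]
    have hsrc := (hball f hf).1
    have htgt : s f ∈ Ψ.target := hsf ▸ Ψ.map_source hsrc
    have hsymm : Ψ.symm (s f) = (entries 1, f) := by rw [← hsf, Ψ.left_inv hsrc]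
    have hc : ∀ᶠ z in 𝓝 (s f), (Ψ.symm z).2 ∈ Ω := by
      refine (continuous_snd.continuousAt.comp (Ψ.continuousAt_symm htgt)).eventually
        (Metric.isOpen_ball.mem_nhds ?_)
      rw [Function.comp_apply, hsymm]
      exact hf
    filter_upwards [Ψ.open_target.mem_nhds htgt, hc] with z hz hzΩ
    have hz' : ofEntries (Ψ.symm z).1 • s (Ψ.symm z).2 = z := by
      rw [← hΨ, Ψ.right_inv hz]
    refine ⟨hz, ⟨(_, _), hzΩ, hz'⟩, ?_⟩
    conv_lhs => rw [← hz']
    exact hpr' _ _ hzΩ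
  have htrans : ∀ (g : GL(m, ℝ)⁺) (y : V), y ∈ U → g • y ∈ U := by
    rintro g _ ⟨p, hp, rfl⟩
    exact ⟨(g * p.1, p.2), hp, mul_smul _ _ _⟩
  have hpr_smul : ∀ (g : GL(m, ℝ)⁺) (y : V), y ∈ U → pr (g • y) = (g * (pr y).1, (pr y).2) := by
    rintro g _ ⟨p, hp, rfl⟩
    rw [smul_smul, hpr' _ _ hp, hpr' _ _ hp]
  have hUopen : IsOpen U := by
    rw [isOpen_iff_mem_nhds]
    rintro _ ⟨⟨g, f⟩, hf, rfl⟩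
    have h1 : ∀ᶠ z in 𝓝 (g • s f), g⁻¹ • z ∈ U := by
      refine (continuous_const_smul g⁻¹).continuousAt.eventually ?_
      simp only [inv_smul_smul]
      exact (hlocal f hf).mono fun z hz => hz.2.1
    filter_upwards [h1] with z hz
    simpa using htrans g _ hz
  have hframe : ∀ y ∈ U, ContMDiffAt 𝓘(ℝ, V) 𝓘(ℝ, Fin m → Fin m → ℝ) ∞ (fun y => (pr y).1) y ∧
      ContMDiffAt 𝓘(ℝ, V) 𝓘(ℝ, E) ∞ (fun y => (pr y).2) y := by
    rintro _ ⟨⟨g, f⟩, hf, rfl⟩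
    have hsym : ContMDiffAt 𝓘(ℝ, V) 𝓘(ℝ, (Fin m → Fin m → ℝ) × E) ∞ Ψ.symm (s f) :=
      (hΨs.contDiffAt (Ψ.open_target.mem_nhds (hlocal f hf).self_of_nhds.1)).contMDiffAt
    have hO : (Ψ.symm (s f)).1 ∈ Set.range entries :=
      hΨO _ (Ψ.map_target (hlocal f hf).self_of_nhds.1)
    have hinv : ContMDiffAt 𝓘(ℝ, V) 𝓘(ℝ, V) ∞ (fun z : V => g⁻¹ • z) (g • s f) :=
      (h.contDiff_const_smul g⁻¹).contMDiff.contMDiffAt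
    have hUn : ∀ᶠ z in 𝓝 (g • s f), g⁻¹ • z ∈ U :=
      Filter.Eventually.mono (hUopen.mem_nhds ⟨(g, f), hf, rfl⟩) fun z hz => htrans g⁻¹ z hz
    constructor
    · have h1 : ContMDiffAt 𝓘(ℝ, V) 𝓘(ℝ, Fin m → Fin m → ℝ) ∞ (fun y => (pr y).1)
          (g⁻¹ • g • s f) := by
        rw [inv_smul_smul]
        have h2 : ContMDiffAt 𝓘(ℝ, V) 𝓘(ℝ, Fin m → Fin m → ℝ) ∞
            (fun z => ofEntries (Ψ.symm z).1) (s f) :=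
          ContMDiffAt.comp (s f) (contMDiffOn_ofEntries.contMDiffAt
            (isOpen_range_entries.mem_nhds hO)) (contDiff_fst.contMDiff.contMDiffAt.comp _ hsym)
        refine h2.congr_of_eventuallyEq ((hlocal f hf).mono fun z hz => ?_)
        exact congrArg Prod.fst hz.2.2
      refine ((contMDiff_mul_left (I := 𝓘(ℝ, Fin m → Fin m → ℝ)) (n := ∞)
        (a := g)).contMDiffAt.comp _ (h1.comp (g • s f) hinv)).congr_of_eventuallyEq ?_
      filter_upwards [hUn] with z hz
      simp [hpr_smul g⁻¹ z (by simpa using htrans g _ hz)]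
    · have h1 : ContMDiffAt 𝓘(ℝ, V) 𝓘(ℝ, E) ∞ (fun y => (pr y).2) (g⁻¹ • g • s f) := by
        rw [inv_smul_smul]
        refine (contDiff_snd.contMDiff.contMDiffAt.comp _ hsym).congr_of_eventuallyEq
          ((hlocal f hf).mono fun z hz => ?_)
        exact congrArg Prod.snd hz.2.2
      refine (h1.comp (g • s f) hinv).congr_of_eventuallyEq ?_
      filter_upwards [hUn] with z hz
      simp [hpr_smul g⁻¹ z (by simpa using htrans g _ hz)]
  refine ⟨{ dom := Ω
            carrier := U
            slice := s
            frame := fun y => (pr y).1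
            coord := fun y => (pr y).2
            isOpen_dom := Metric.isOpen_ball
            isOpen_carrier := hUopen
            contMDiffOn_slice := hs.contMDiff.contMDiffOn
            contMDiffOn_frame := fun y hy => (hframe y hy).1.contMDiffWithinAt
            contMDiffOn_coord := fun y hy => (hframe y hy).2.contMDiffWithinAt
            coord_mem := fun y hy => (hpr y hy).1
            frame_smul_slice := fun y hy => (hpr y hy).2
            smul_slice_mem := fun g f hf => ⟨(g, f), hf, rfl⟩
            frame_smul := fun g f hf => congrArg Prod.fst (hpr' g f hf)
            coord_smul := fun g f hf => congrArg Prod.snd (hpr' g f hf) }, ?_, ?_⟩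
  · exact ⟨(1, 0), Metric.mem_ball_self hε, by simp [s]⟩
  -- A stabilizing element returns a disc point to itself, so isolation with `f' = f` makes it
  -- trivial.
  · rintro _ ⟨⟨g, f⟩, hf, rfl⟩
    refine W.trivialIsotropy.smul_mem g ⟨(hball f hf).2.1, ?_⟩
    rw [Subgroup.eq_bot_iff_forall]
    intro k hk
    exact ((hball f hf).2.2 f hf k hk).1

theorem isOpen_trivialIsotropy (h : IsSmoothAction m V) {W : SubMulAction GL(m, ℝ)⁺ V}
    (hW : IsOpen (W : Set V)) (hprop : IsProperAction GL(m, ℝ)⁺ W) :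
    IsOpen (W.trivialIsotropy : Set V) := by
  rw [isOpen_iff_mem_nhds]
  intro x hx
  obtain ⟨σ, hxσ, hσ⟩ := h.exists_localSlice hW hprop hx
  exact mem_of_superset (σ.isOpen_carrier.mem_nhds hxσ) hσ

end IsSmoothAction

end ProperAction

/-! ### The quotient of a proper free action -/

section OpenInvariant

variable {G V : Type*} [Group G] [NormedAddCommGroup V] [NormedSpace ℝ V] [MulAction G V]
  (N : SubMulAction G V) (hN : IsOpen (N : Set V))

/-- An open invariant subset of a normed space as a manifold. -/
abbrev SubMulAction.openChartedSpace : ChartedSpace V N :=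
  inferInstanceAs (ChartedSpace V (⟨N, hN⟩ : TopologicalSpace.Opens V))

theorem SubMulAction.contMDiff_val :
    letI := N.openChartedSpace hN
    ContMDiff 𝓘(ℝ, V) 𝓘(ℝ, V) ∞ (Subtype.val : N → V) :=
  contMDiff_subtype_val (U := (⟨N, hN⟩ : TopologicalSpace.Opens V))

theorem SubMulAction.contMDiffWithinAt_of_val_comp {E H M : Type*} [NormedAddCommGroup E]
    [NormedSpace ℝ E] [TopologicalSpace H] {I : ModelWithCorners ℝ E H} [TopologicalSpace M]
    [ChartedSpace H M] {f : M → N} {s : Set M} {x : M}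
    (hf : ContMDiffWithinAt I 𝓘(ℝ, V) ∞ (fun x => (f x : V)) s x) :
    letI := N.openChartedSpace hN
    ContMDiffWithinAt I 𝓘(ℝ, V) ∞ f s x :=
  (ContMDiffWithinAt.subtypeVal_comp_iff (⟨N, hN⟩ : TopologicalSpace.Opens V) f s x).1 hf

variable {EG : Type*} [NormedAddCommGroup EG] [NormedSpace ℝ EG] [TopologicalSpace G]
  [ChartedSpace EG G]

open Classical in
/-- The restriction of a local slice to an open invariant subset. -/
def LocalSlice.restrict {EB : Type*} [NormedAddCommGroup EB] [NormedSpace ℝ EB]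
    (σ : LocalSlice EG V EB G V) (hσ : σ.carrier ⊆ N) (x₀ : N) :
    letI := N.openChartedSpace hN
    LocalSlice EG V EB G N :=
  letI := N.openChartedSpace hN
  have hmem : ∀ f ∈ σ.dom, σ.slice f ∈ N := fun _ hf => hσ (σ.slice_mem hf)
  -- Slices are total functions, so `x₀` serves as a default value off `σ.dom`.
  let s : EB → N := fun f => if h : f ∈ σ.dom then ⟨σ.slice f, hmem f h⟩ else x₀
  have hs : ∀ f ∈ σ.dom, (s f : V) = σ.slice f := fun f hf => by simp only [s, dif_pos hf]
  { dom := σ.dom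
    carrier := Subtype.val ⁻¹' σ.carrier
    slice := s
    frame := fun y => σ.frame y
    coord := fun y => σ.coord y
    isOpen_dom := σ.isOpen_dom
    isOpen_carrier := σ.isOpen_carrier.preimage continuous_subtype_val
    contMDiffOn_slice := fun f hf => N.contMDiffWithinAt_of_val_comp hN
      ((σ.contMDiffOn_slice f hf).congr hs (hs f hf))
    contMDiffOn_frame := σ.contMDiffOn_frame.comp (N.contMDiff_val hN).contMDiffOn fun _ hy => hy
    contMDiffOn_coord := σ.contMDiffOn_coord.comp (N.contMDiff_val hN).contMDiffOn fun _ hy => hy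
    coord_mem := fun y hy => σ.coord_mem y hy
    frame_smul_slice := fun y hy => Subtype.ext (by
      rw [SubMulAction.val_smul, hs _ (σ.coord_mem y hy), σ.frame_smul_slice y hy])
    smul_slice_mem := fun g f hf => by
      rw [Set.mem_preimage, SubMulAction.val_smul, hs f hf]
      exact σ.smul_slice_mem g f hf
    frame_smul := fun g f hf => by rw [SubMulAction.val_smul, hs f hf, σ.frame_smul g f hf]
    coord_smul := fun g f hf => by rw [SubMulAction.val_smul, hs f hf, σ.coord_smul g f hf] }

theorem LocalSlice.mem_carrier_restrict {EB : Type*} [NormedAddCommGroup EB] [NormedSpace ℝ EB]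
    (σ : LocalSlice EG V EB G V) (hσ : σ.carrier ⊆ N) (x₀ y : N) (hy : (y : V) ∈ σ.carrier) :
    letI := N.openChartedSpace hN
    y ∈ (σ.restrict N hN hσ x₀).carrier := hy

end OpenInvariant

/-- For an open quotient map, Hausdorff means that the orbit relation is closed. First countability
lets sequences test this, and the limit of the subsequence of group elements relates the two limits.
-/
theorem IsProperAction.t2Space_quotient {G X : Type*} [TopologicalSpace G] [TopologicalSpace X]
    [Group G] [MulAction G X] [ContinuousSMul G X] [T2Space X] [FirstCountableTopology X]
    (h : IsProperAction G X) : T2Space (Quotient (MulAction.orbitRel G X)) := by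
  rw [t2Space_iff_of_isOpenQuotientMap MulAction.isOpenQuotientMap_quotientMk]
  refine IsSeqClosed.isClosed ?_
  intro u p hu hp
  have hrel : ∀ n, ∃ g : G, g • (u n).2 = (u n).1 := fun n => by
    have h1 : (MulAction.orbitRel G X) (u n).1 (u n).2 := Quotient.exact (hu n)
    rwa [MulAction.orbitRel_apply] at h1
  choose g hg using hrel
  have h1 : Tendsto (fun n => (u n).1) atTop (𝓝 p.1) := (continuous_fst.tendsto p).comp hp
  have h2 : Tendsto (fun n => (u n).2) atTop (𝓝 p.2) := (continuous_snd.tendsto p).comp hp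
  obtain ⟨φ, k, hφ, hk⟩ := h _ g p.2 p.1 h2 (by simpa only [hg] using h1)
  have h3 : Tendsto (fun n => g (φ n) • (u (φ n)).2) atTop (𝓝 (k • p.2)) :=
    hk.smul (h2.comp hφ.tendsto_atTop)
  simp only [hg] at h3
  refine Quotient.sound ?_
  change (MulAction.orbitRel G X) _ _
  rw [MulAction.orbitRel_apply]
  exact ⟨k, tendsto_nhds_unique h3 (h1.comp hφ.tendsto_atTop)⟩

/-- Properness only tests limits inside the space, so it passes to invariant subsets that are not
closed. -/
theorem IsProperAction.mono {G X : Type*} [TopologicalSpace G] [TopologicalSpace X] [Group G]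
    [MulAction G X] {M N : SubMulAction G X} (h : IsProperAction G N) (hMN : ∀ x ∈ M, x ∈ N) :
    IsProperAction G M := by
  intro x g a b hx hg
  refine h (fun n => ⟨x n, hMN _ (x n).2⟩) g ⟨a, hMN _ a.2⟩ ⟨b, hMN _ b.2⟩ ?_ ?_
  · exact tendsto_subtype_rng.2 ((continuous_subtype_val.tendsto a).comp hx)
  · exact tendsto_subtype_rng.2 ((continuous_subtype_val.tendsto b).comp hg)

theorem IsSmoothAction.hasPrincipalQuotient {m : ℕ} {V : Type*} [NormedAddCommGroup V]
    [NormedSpace ℝ V] [MulAction GL(m, ℝ)⁺ V] [FiniteDimensional ℝ V] (h : IsSmoothAction m V)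
    {W : SubMulAction GL(m, ℝ)⁺ V} (hW : IsOpen (W : Set V))
    (hprop : IsProperAction GL(m, ℝ)⁺ W) :
    HasPrincipalQuotient (Fin m → Fin m → ℝ) W.trivialIsotropy
      (h.isOpen_trivialIsotropy hW hprop) := by
  have := h.continuousSMul
  have hN := h.isOpen_trivialIsotropy hW hprop
  have : ProperSpace V := FiniteDimensional.proper_real V
  have : SecondCountableTopology V := secondCountable_of_proper
  have : ContinuousSMul GL(m, ℝ)⁺ W.trivialIsotropy :=
    ⟨(continuous_fst.smul (continuous_subtype_val.comp continuous_snd)).subtype_mk _⟩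
  let := W.trivialIsotropy.openChartedSpace hN
  choose σ hσ hσN using fun x : W.trivialIsotropy => h.exists_localSlice hW hprop x.2
  let s := fun x : W.trivialIsotropy => (σ x).restrict W.trivialIsotropy hN (hσN x) x
  have hs : ∀ x, x ∈ (s x).carrier := fun x =>
    (σ x).mem_carrier_restrict W.trivialIsotropy hN (hσN x) x x (hσ x)
  have hsmul : ContMDiff (𝓘(ℝ, Fin m → Fin m → ℝ).prod 𝓘(ℝ, V)) 𝓘(ℝ, V) ∞
      fun x : GL(m, ℝ)⁺ × W.trivialIsotropy => x.1 • x.2 := by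
    have h1 : ContMDiff (𝓘(ℝ, Fin m → Fin m → ℝ).prod 𝓘(ℝ, V)) 𝓘(ℝ, V) ∞
        fun x : GL(m, ℝ)⁺ × W.trivialIsotropy => x.1 • (x.2 : V) :=
      ContMDiff.comp (g := fun x : GL(m, ℝ)⁺ × V => x.1 • x.2) h (contMDiff_fst.prodMk
        ((W.trivialIsotropy.contMDiff_val hN).comp contMDiff_snd))
    exact fun x => W.trivialIsotropy.contMDiffWithinAt_of_val_comp hN (h1 x)
  have hT2 := (IsProperAction.mono (M := W.trivialIsotropy) hprop fun x hx => hx.1).t2Space_quotient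
  refine ⟨hT2,
    ContinuousConstSMul.secondCountableTopology, _, LocalSlice.chartedSpace s hs,
    LocalSlice.isManifold s hs, LocalSlice.isSmoothPrincipalBundle s hs hsmul, fun U f hU => ?_⟩
  exact LocalSlice.contMDiffOn_iff_comp_mk s hs U hU f

/-! ### Smoothness of the action on Christoffel symbols -/

/-- Smoothness is checked in `V` and returned to `U` by `L`, which need not be equivariant. -/
theorem IsSmoothAction.of_leftInverse {m : ℕ} {U V : Type*} [NormedAddCommGroup U] [NormedSpace ℝ U]
    [NormedAddCommGroup V] [NormedSpace ℝ V] [MulAction GL(m, ℝ)⁺ U] [MulAction GL(m, ℝ)⁺ V]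
    (h : IsSmoothAction m V) (ι : U →L[ℝ] V) (L : V →L[ℝ] U) (hL : ∀ x, L (ι x) = x)
    (hι : ∀ (g : GL(m, ℝ)⁺) (x : U), ι (g • x) = g • ι x) : IsSmoothAction m U := by
  have h1 : ContMDiff (𝓘(ℝ, Fin m → Fin m → ℝ).prod 𝓘(ℝ, U)) 𝓘(ℝ, V) ∞
      fun x : GL(m, ℝ)⁺ × U => x.1 • ι x.2 :=
    ContMDiff.comp (g := fun x : GL(m, ℝ)⁺ × V => x.1 • x.2) h
      (contMDiff_fst.prodMk (ι.contDiff.contMDiff.comp contMDiff_snd))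
  refine (L.contDiff.contMDiff.comp h1).congr fun x => ?_
  rw [Function.comp_apply, ← hι, hL]

namespace Christoffel

open GLPos

variable {m : ℕ}

theorem isSmoothAction : IsSmoothAction m (Christoffel m) := by
  let E := Fin m → Fin m → ℝ
  have hP : ContDiff ℝ ∞ fun x : E × E × Christoffel m =>
      (fun i j k => ∑ a, ∑ b, ∑ c, x.1 a i * x.1 b j * x.2.1 k c * x.2.2 a b c :
        Christoffel m) := by
    have : ContDiff ℝ ∞ fun x : E × E × (Fin m → Fin m → Fin m → ℝ) =>
        (fun i j k => ∑ a, ∑ b, ∑ c, x.1 a i * x.1 b j * x.2.1 k c * x.2.2 a b c :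
          Fin m → Fin m → Fin m → ℝ) := by
      fun_prop
    exact this
  have h1 : ContMDiff (𝓘(ℝ, E).prod 𝓘(ℝ, Christoffel m)) 𝓘(ℝ, E) ∞
      fun x : GL(m, ℝ)⁺ × Christoffel m => entries x.1⁻¹ :=
    contMDiff_entries.comp ((contMDiff_inv 𝓘(ℝ, E) ∞).comp contMDiff_fst)
  have h2 : ContMDiff (𝓘(ℝ, E).prod 𝓘(ℝ, Christoffel m)) 𝓘(ℝ, E) ∞
      fun x : GL(m, ℝ)⁺ × Christoffel m => entries x.1 :=
    contMDiff_entries.comp contMDiff_fst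
  have h4 := hP.contMDiff.comp (h1.prodMk_space (h2.prodMk_space contMDiff_snd))
  refine ContMDiff.congr h4 fun x => ?_
  funext i j k
  change changeFrame (x.1 : GL (Fin m) ℝ)⁻¹ x.2 i j k = _
  simp only [changeFrame, inv_inv]
  rfl

theorem isSmoothAction_symm : IsSmoothAction m (symm m) := by
  obtain ⟨L, hL⟩ := LinearMap.exists_leftInverse_of_injective (symm m).subtype
    (Submodule.ker_subtype _)
  exact isSmoothAction.of_leftInverse (symm m).subtypeL (LinearMap.toContinuousLinearMap L)
    (fun x => LinearMap.congr_fun hL x) fun _ _ => rfl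

end Christoffel

/-! ### Definite forms -/

section Definite

variable {m : ℕ}

theorem sigPos_eq_iff_posDef (Q : QuadraticForm ℝ (Fin m → ℝ)) : sigPos Q = m ↔ Q.PosDef := by
  have hfin : Module.finrank ℝ (Fin m → ℝ) = m := by simp
  constructor
  · intro h
    obtain ⟨V, hV, hpos⟩ := exists_finrank_eq_sigPos_and_posDef Q
    have hV' : V = ⊤ := Submodule.eq_top_of_finrank_eq (by rw [hV, h, hfin])
    intro x hx
    have hxV : x ∈ V := hV' ▸ Submodule.mem_top
    exact hpos ⟨x, hxV⟩ fun h0 => hx (congrArg Subtype.val h0)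
  · intro h
    refine le_antisymm ((sigPos_le_finrank Q).trans hfin.le) ?_
    have h1 : (Q.restrict (⊤ : Submodule ℝ (Fin m → ℝ))).PosDef := fun x hx =>
      h x fun h0 => hx (Subtype.ext h0)
    simpa using le_sigPos_of_posDef Q h1

theorem signature_eq_iff_posDef (Q : QuadraticForm ℝ (Fin m → ℝ)) :
    (sigNeg Q = 0 ∧ sigPos Q = m) ↔ Q.PosDef := by
  rw [← sigPos_eq_iff_posDef, and_iff_right_iff_imp]
  intro h
  have h1 := QuadraticForm.sigPos_add_sigNeg_add_radical (Q := Q)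
  simp only [Module.finrank_fintype_fun_eq_card, Fintype.card_fin] at h1
  lia

/-- Positive definite bilinear forms are locally uniformly positive definite. -/
theorem eventually_forall_le_dotProduct_mulVec {A : Matrix (Fin m) (Fin m) ℝ}
    (hA : ∀ x, x ≠ 0 → 0 < x ⬝ᵥ A *ᵥ x) :
    ∃ c > 0, ∀ᶠ B in 𝓝 A, ∀ x, c * ‖x‖ ^ 2 ≤ x ⬝ᵥ B *ᵥ x := by
  have hcont : Continuous fun p : Matrix (Fin m) (Fin m) ℝ × (Fin m → ℝ) => p.2 ⬝ᵥ p.1 *ᵥ p.2 :=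
    continuous_snd.dotProduct (continuous_fst.matrix_mulVec continuous_snd)
  have hK : IsCompact (Metric.sphere (0 : Fin m → ℝ) 1) := isCompact_sphere _ _
  obtain ⟨c, hc, hcA⟩ := hK.exists_forall_le' (f := fun x => x ⬝ᵥ A *ᵥ x)
    (hcont.comp (Continuous.prodMk_right A)).continuousOn (a := 0) fun x hx =>
      hA x (ne_zero_of_mem_unit_sphere ⟨x, hx⟩)
  -- Halving the lower bound on the sphere leaves a strict inequality, which persists near `A` by
  -- compactness.
  refine ⟨c / 2, half_pos hc, ?_⟩
  have hev : ∀ᶠ B in 𝓝 A, ∀ x ∈ Metric.sphere (0 : Fin m → ℝ) 1, c / 2 < x ⬝ᵥ B *ᵥ x := by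
    refine hK.eventually_forall_of_forall_eventually fun x hx => ?_
    exact (hcont.tendsto (A, x)).eventually (lt_mem_nhds (by linarith [hcA x hx]))
  filter_upwards [hev] with B hB x
  rcases eq_or_ne x 0 with rfl | hx
  · simp
  have hn : ‖x‖ ≠ 0 := norm_ne_zero_iff.2 hx
  have h1 := hB (‖x‖⁻¹ • x) (by simp [norm_smul, hn])
  rw [Matrix.mulVec_smul, dotProduct_smul, smul_dotProduct, smul_eq_mul, smul_eq_mul] at h1
  have h2 : x ⬝ᵥ B *ᵥ x = ‖x‖ ^ 2 * (‖x‖⁻¹ * (‖x‖⁻¹ * x ⬝ᵥ B *ᵥ x)) := by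
    field_simp
  rw [h2, mul_comm]
  exact mul_le_mul_of_nonneg_left h1.le (sq_nonneg _)

end Definite

namespace Christoffel

variable {m : ℕ}

theorem toQuadraticForm'_symRicci_apply (Γ : Christoffel m) (x : Fin m → ℝ) :
    Γ.symRicci.toQuadraticForm' x = x ⬝ᵥ Γ.symRicci *ᵥ x := by
  change Matrix.toLinearMap₂' ℝ Γ.symRicci x x = _
  exact Matrix.toLinearMap₂'_apply' Γ.symRicci x x

/-- In the definite case, the signature condition is the definiteness of the symmetric Ricci
tensor. -/
theorem exists_hasSignature_iff {p q : ℕ} (hpq : (p, q) = (m, 0) ∨ (p, q) = (0, m)) :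
    ∃ c : ℝ, ∀ Γ : Christoffel m, Γ.HasSignature p q ↔
      ∀ x, x ≠ 0 → 0 < x ⬝ᵥ (c • Γ.symRicci) *ᵥ x := by
  rcases hpq with h | h <;> obtain ⟨rfl, rfl⟩ := Prod.mk.inj h
  · refine ⟨-1, fun Γ => ?_⟩
    have h1 := signature_eq_iff_posDef (-Γ.symRicci.toQuadraticForm')
    rw [sigNeg_neg, sigPos_neg] at h1
    rw [HasSignature, and_comm, h1]
    refine forall₂_congr fun x _ => ?_
    rw [neg_apply, toQuadraticForm'_symRicci_apply, Matrix.smul_mulVec,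
      dotProduct_smul, neg_one_smul]
  · refine ⟨1, fun Γ => ?_⟩
    rw [HasSignature, signature_eq_iff_posDef]
    refine forall₂_congr fun x _ => ?_
    rw [toQuadraticForm'_symRicci_apply, one_smul]

theorem continuous_symRicci : Continuous (symRicci (m := m)) := by
  have h : Continuous (ricci (m := m)) := by
    have : Continuous fun Γ : Fin m → Fin m → Fin m → ℝ => (fun j k =>
        ∑ i, ∑ n, (Γ i n i * Γ j k n - Γ j n i * Γ i k n) : Fin m → Fin m → ℝ) := by fun_prop
    exact this
  exact (h.add h.matrix_transpose).const_smul (1 / 2 : ℝ)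

theorem dotProduct_symRicci_smul (T : GL(m, ℝ)⁺) (Γ : Christoffel m) (x : Fin m → ℝ) :
    x ⬝ᵥ (T • Γ).symRicci *ᵥ x =
      ((T⁻¹ : GL(m, ℝ)⁺) : GL (Fin m) ℝ).1 *ᵥ x ⬝ᵥ
        Γ.symRicci *ᵥ (((T⁻¹ : GL(m, ℝ)⁺) : GL (Fin m) ℝ).1 *ᵥ x) := by
  change x ⬝ᵥ (changeFrame (T : GL (Fin m) ℝ)⁻¹ Γ).symRicci *ᵥ x = _
  rw [symRicci_changeFrame, ← Matrix.mulVec_mulVec, ← Matrix.mulVec_mulVec,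
    Matrix.mulVec_transpose, dotProduct_comm x, ← Matrix.dotProduct_mulVec, dotProduct_comm]
  rfl

variable {p q : ℕ}

theorem isOpen_W (hpq : (p, q) = (m, 0) ∨ (p, q) = (0, m)) :
    IsOpen (W m p q : Set (Christoffel m)) := by
  obtain ⟨c, hc⟩ := exists_hasSignature_iff hpq
  rw [isOpen_iff_mem_nhds]
  intro Γ hΓ
  obtain ⟨d, hd, hev⟩ := eventually_forall_le_dotProduct_mulVec ((hc Γ).1 hΓ)
  filter_upwards [(continuous_symRicci.const_smul c).continuousAt.eventually hev] with Δ hΔ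
  refine (hc Δ).2 fun x hx => lt_of_lt_of_le ?_ (hΔ x)
  have := norm_pos_iff.2 hx
  positivity

theorem isOpen_Z (hpq : (p, q) = (m, 0) ∨ (p, q) = (0, m)) :
    IsOpen (Z m p q : Set (symm m)) :=
  (isOpen_W hpq).preimage continuous_subtype_val

/-! ### Properness of the action on definite symbols. -/

/-- Column `j` of `T_n⁻¹` has squared length, in the form of `Γ_n`, equal to the `j`-th diagonal
entry of the form of `T_n • Γ_n`. These entries converge, and uniform definiteness near `a` bounds
the column. -/
theorem exists_eventually_norm_entries_inv_le (hpq : (p, q) = (m, 0) ∨ (p, q) = (0, m))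
    {Γ : ℕ → Christoffel m} {T : ℕ → GL(m, ℝ)⁺} {a b : Christoffel m} (ha : a ∈ W m p q)
    (hΓ : Tendsto Γ atTop (𝓝 a)) (hT : Tendsto (fun n => T n • Γ n) atTop (𝓝 b)) :
    ∃ C, ∀ᶠ n in atTop, ‖GLPos.entries (T n)⁻¹‖ ≤ C := by
  obtain ⟨c, hc⟩ := exists_hasSignature_iff hpq
  obtain ⟨d, hd, hev⟩ := eventually_forall_le_dotProduct_mulVec ((hc a).1 ha)
  have hev' := ((continuous_symRicci.const_smul c).tendsto a).comp hΓ |>.eventually hev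
  have hdiag : ∀ j : Fin m, ∃ C : ℝ, ∀ᶠ n in atTop,
      Pi.single j 1 ⬝ᵥ (c • (T n • Γ n).symRicci) *ᵥ Pi.single j 1 ≤ C := by
    intro j
    have hcont : Continuous fun Δ : Christoffel m =>
        Pi.single j 1 ⬝ᵥ (c • Δ.symRicci) *ᵥ Pi.single j 1 :=
      continuous_const.dotProduct
        ((continuous_symRicci.const_smul c).matrix_mulVec continuous_const)
    refine ⟨_, ((hcont.tendsto b).comp hT).eventually (ge_mem_nhds (lt_add_one _))⟩
  choose C hC using hdiag
  -- The square of each entry in column `j` is at most `C j / d`, and `|s| ≤ s² + 1` avoids a square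
  -- root.
  refine ⟨∑ j, (C j / d + 1), ?_⟩
  filter_upwards [hev', eventually_all.2 hC] with n h1 h2
  have hcol : ∀ i j, |GLPos.entries (T n)⁻¹ i j| ≤ C j / d + 1 := by
    intro i j
    set S := (((T n)⁻¹ : GL(m, ℝ)⁺) : GL (Fin m) ℝ).1 with hS
    have h3 := h2 j
    rw [Matrix.smul_mulVec, dotProduct_smul, dotProduct_symRicci_smul, ← dotProduct_smul,
      ← Matrix.smul_mulVec] at h3
    have h4 := (h1 (S *ᵥ Pi.single j 1)).trans h3
    have h5 : |S i j| ≤ ‖S *ᵥ Pi.single j 1‖ := by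
      have := norm_le_pi_norm (S *ᵥ Pi.single j 1) i
      simpa using this
    have h6 : |S i j| ^ 2 ≤ C j / d := by
      rw [le_div_iff₀' hd]
      refine le_trans ?_ h4
      gcongr
    change |S i j| ≤ _
    nlinarith [sq_nonneg (|S i j| - 1), abs_nonneg (S i j)]
  have hnn : ∀ i j, 0 ≤ C j / d + 1 := fun i j => (abs_nonneg _).trans (hcol i j)
  have hsum : ∀ i j : Fin m, C j / d + 1 ≤ ∑ j, (C j / d + 1) := fun i j =>
    Finset.single_le_sum (f := fun j => C j / d + 1) (fun k _ => hnn i k) (Finset.mem_univ j)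
  have h0 : 0 ≤ ∑ j, (C j / d + 1) := Finset.sum_nonneg fun j _ => hnn j j
  exact (pi_norm_le_iff_of_nonneg h0).2 fun i => (pi_norm_le_iff_of_nonneg h0).2 fun j =>
    (hcol i j).trans (hsum i j)

/-- The bound on inverses is also applied to `T_n⁻¹` with `a` and `b` exchanged, so definiteness at
both limits is used. In the limit the determinant is nonnegative, and it is nonzero because the
limits of `T_n` and `T_n⁻¹` are inverse. -/
theorem exists_subseq_tendsto (hpq : (p, q) = (m, 0) ∨ (p, q) = (0, m))
    {Γ : ℕ → Christoffel m} {T : ℕ → GL(m, ℝ)⁺} {a b : Christoffel m} (ha : a ∈ W m p q)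
    (hb : b ∈ W m p q) (hΓ : Tendsto Γ atTop (𝓝 a))
    (hT : Tendsto (fun n => T n • Γ n) atTop (𝓝 b)) :
    ∃ (φ : ℕ → ℕ) (S : GL(m, ℝ)⁺), StrictMono φ ∧ Tendsto (fun n => T (φ n)) atTop (𝓝 S) := by
  obtain ⟨C, hC⟩ := exists_eventually_norm_entries_inv_le hpq ha hΓ hT
  obtain ⟨C', hC'⟩ := exists_eventually_norm_entries_inv_le (T := fun n => (T n)⁻¹) hpq hb hT
    (by simpa using hΓ)
  let E := Fin m → Fin m → ℝ
  let u : ℕ → E × E := fun n => (GLPos.entries (T n), GLPos.entries (T n)⁻¹)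
  have hu : ∀ᶠ n in atTop, u n ∈ Metric.closedBall 0 (max C C') := by
    filter_upwards [hC, hC'] with n h1 h2
    rw [inv_inv] at h2
    rw [mem_closedBall_zero_iff, Prod.norm_def]
    exact max_le (h2.trans (le_max_right _ _)) (h1.trans (le_max_left _ _))
  obtain ⟨⟨A, B⟩, -, φ, hφ, hlim⟩ := tendsto_subseq_of_frequently_bounded
    Metric.isBounded_closedBall hu.frequently
  have hA : Tendsto (fun n => GLPos.entries (T (φ n))) atTop (𝓝 A) :=
    (continuous_fst.tendsto (A, B)).comp hlim
  have hB : Tendsto (fun n => GLPos.entries (T (φ n))⁻¹) atTop (𝓝 B) :=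
    (continuous_snd.tendsto (A, B)).comp hlim
  have hmul : Matrix.of A * Matrix.of B = 1 := by
    have hcont : Continuous fun x : E × E =>
        (Matrix.of x.1 * Matrix.of x.2 : Matrix (Fin m) (Fin m) ℝ) :=
      Continuous.matrix_mul continuous_fst continuous_snd
    refine tendsto_nhds_unique ((hcont.tendsto (A, B)).comp hlim) ?_
    refine tendsto_const_nhds.congr fun n => ?_
    exact ((T (φ n) : GL (Fin m) ℝ).mul_inv).symm
  have hdet : 0 < (Matrix.of A).det := by
    have hnn : 0 ≤ (Matrix.of A).det := by
      refine ge_of_tendsto (((GLPos.contDiff_det.continuous).tendsto A).comp hA)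
        (Eventually.of_forall fun n => ?_)
      exact (T (φ n)).2.le
    refine hnn.lt_of_ne fun h0 => ?_
    have h1 := congrArg Matrix.det hmul
    rw [Matrix.det_mul, ← h0, zero_mul, Matrix.det_one] at h1
    exact zero_ne_one h1
  let S : GL(m, ℝ)⁺ := ⟨⟨Matrix.of A, Matrix.of B, hmul, mul_eq_one_comm.1 hmul⟩, hdet⟩
  refine ⟨φ, S, hφ, ?_⟩
  rw [GLPos.isOpenEmbedding_entries.tendsto_nhds_iff]
  exact hA

theorem isProperAction_W (hpq : (p, q) = (m, 0) ∨ (p, q) = (0, m)) :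
    IsProperAction GL(m, ℝ)⁺ (W m p q) := fun _ _ a b hx hg =>
  exists_subseq_tendsto hpq a.2 b.2 ((continuous_subtype_val.tendsto a).comp hx)
    ((continuous_subtype_val.tendsto b).comp hg)

theorem isProperAction_Z (hpq : (p, q) = (m, 0) ∨ (p, q) = (0, m)) :
    IsProperAction GL(m, ℝ)⁺ (Z m p q) := fun _ _ a b hx hg =>
  have hcont : Continuous fun x : Z m p q => ((x : symm m) : Christoffel m) :=
    continuous_subtype_val.comp continuous_subtype_val
  exists_subseq_tendsto hpq a.2 b.2 ((hcont.tendsto a).comp hx) ((hcont.tendsto b).comp hg)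

end Christoffel

/-! ### Density of the Christoffel symbols with trivial isotropy group -/

theorem contDiff_matrix_det {m : ℕ} {n : ℕ∞ω} :
    ContDiff ℝ n fun A : Fin m → Fin m → ℝ => (Matrix.of A).det := by
  simp only [Matrix.det_apply]
  refine ContDiff.sum fun σ _ => ContDiff.const_smul _ (contDiff_prod fun i _ => ?_)
  simp only [Matrix.of_apply]
  fun_prop

theorem contDiff_matrix_adjugate {m : ℕ} {n : ℕ∞ω} (i j : Fin m) :
    ContDiff ℝ n fun A : Fin m → Fin m → ℝ => (Matrix.of A).adjugate i j := by
  simp only [Matrix.adjugate_apply]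
  have h : ContDiff ℝ n fun A : Fin m → Fin m → ℝ =>
      (fun k l => (Matrix.of A).updateRow j (Pi.single i 1) k l : Fin m → Fin m → ℝ) := by
    refine contDiff_pi.2 fun k => contDiff_pi.2 fun l => ?_
    simp only [Matrix.updateRow_apply]
    split_ifs
    · exact contDiff_const
    · simp only [Matrix.of_apply]
      fun_prop
  exact contDiff_matrix_det.comp h

/-- The set of zeros of a nonzero analytic function has no interior. -/
theorem dense_ne_zero_of_contDiff_omega {V : Type*} [NormedAddCommGroup V] [NormedSpace ℝ V]
    {f : V → ℝ} (hf : ContDiff ℝ ω f) {x₀ : V} (hx₀ : f x₀ ≠ 0) {W : Set V} (hW : IsOpen W) :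
    Dense {x : W | f x ≠ 0} := by
  intro x
  rw [mem_closure_iff_frequently]
  intro h
  have h1 : ∀ᶠ y in 𝓝 (x : V), f y = 0 := by
    rw [← hW.isOpenEmbedding_subtypeVal.map_nhds_eq x, eventually_map]
    exact h.mono fun y hy => not_not.1 hy
  have h2 : f = fun _ => 0 :=
    (contDiff_omega_iff_analyticOnNhd.1 hf).eq_of_eventuallyEq analyticOnNhd_const h1
  exact hx₀ (congrFun h2 x₀)

namespace Christoffel

variable {m : ℕ}

/-- The covector `x ↦ tr Γ(x, ·)`. -/
def traceCovector (Γ : Christoffel m) : Fin m → ℝ := fun i => ∑ j, Γ i j j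

/-- The bilinear form `(x, y) ↦ tr Γ(Γ(x, y), ·)`. -/
def traceForm (Γ : Christoffel m) : Matrix (Fin m) (Fin m) ℝ :=
  Matrix.of fun i j => ∑ n, Γ i j n * Γ.traceCovector n

/-- A sequence of vectors attached to `Γ`: each one is obtained from the previous one by
`v ↦ Γ(v, v)`. -/
def vec (Γ : Christoffel m) : ℕ → Fin m → ℝ
  | 0 => Γ.traceForm.adjugate *ᵥ Γ.traceCovector
  | k + 1 => fun c => ∑ a, ∑ b, vec Γ k a * vec Γ k b * Γ a b c

/-- The determinant of the first `m` vectors of the sequence `vec`. -/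
def frameDet (Γ : Christoffel m) : ℝ := (Matrix.of fun k : Fin m => Γ.vec k).det

theorem contDiff_traceCovector : ContDiff ℝ ω (traceCovector (m := m)) := by
  have : ContDiff ℝ ω fun Γ : Fin m → Fin m → Fin m → ℝ =>
    (fun i => ∑ j, Γ i j j : Fin m → ℝ) := by fun_prop
  exact this

theorem contDiff_apply (i j k : Fin m) : ContDiff ℝ ω fun Γ : Christoffel m => Γ i j k := by
  have : ContDiff ℝ ω fun Γ : Fin m → Fin m → Fin m → ℝ => Γ i j k := by fun_prop
  exact this

theorem contDiff_vec (k : ℕ) : ContDiff ℝ ω fun Γ : Christoffel m => Γ.vec k := by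
  induction k with
  | zero =>
    have hb : ContDiff ℝ ω fun Γ : Christoffel m =>
        (fun i j => ∑ n, Γ i j n * Γ.traceCovector n : Fin m → Fin m → ℝ) :=
      contDiff_pi.2 fun i => contDiff_pi.2 fun j => ContDiff.sum fun n _ =>
        (contDiff_apply i j n).mul (contDiff_pi.1 contDiff_traceCovector n)
    refine contDiff_pi.2 fun i => ?_
    change ContDiff ℝ ω fun Γ : Christoffel m =>
      ∑ j, Γ.traceForm.adjugate i j * Γ.traceCovector j
    refine ContDiff.sum fun j _ => ?_
    exact ((contDiff_matrix_adjugate i j).comp hb).mul (contDiff_pi.1 contDiff_traceCovector j)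
  | succ k ih =>
    have ih' := contDiff_pi.1 ih
    exact contDiff_pi.2 fun c => ContDiff.sum fun a _ => ContDiff.sum fun b _ =>
      ((ih' a).mul (ih' b)).mul (contDiff_apply a b c)

theorem contDiff_frameDet : ContDiff ℝ ω (frameDet (m := m)) :=
  contDiff_matrix_det.comp (contDiff_pi.2 fun k : Fin m => contDiff_vec k)

/-! ### Tensors and vectors preserved by isotropy elements. -/

section Stabilizer

variable {Γ : Christoffel m} {S : GL (Fin m) ℝ}

/-- Clearing the inverse matrix turns invariance into `S Γ(e_i, e_j) = Γ(S e_i, S e_j)`. -/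
theorem sum_mul_of_changeFrame_eq (h : changeFrame S Γ = Γ) (i j l : Fin m) :
    ∑ k, S.1 l k * Γ i j k = ∑ a, ∑ b, S.1 a i * S.1 b j * Γ a b l := by
  have h1 : Matrix.of (Γ i) * S.1ᵀ = S.1ᵀ * ∑ a, S.1 a i • Matrix.of (Γ a) := by
    have h2 := changeFrame_eq S Γ i
    rw [h] at h2
    have h3 : S⁻¹.1ᵀ * S.1ᵀ = 1 := by
      rw [← Matrix.transpose_mul, ← Units.val_mul]
      simp
    rw [h2, Matrix.mul_assoc, h3, Matrix.mul_one]
  have h4 := congrFun (congrFun h1 j) l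
  simp only [Matrix.mul_apply, Matrix.of_apply, Matrix.transpose_apply, Matrix.sum_apply,
    Matrix.smul_apply, smul_eq_mul, Finset.mul_sum] at h4
  calc
    _ = ∑ k, Γ i j k * S.1 l k := Finset.sum_congr rfl fun k _ => mul_comm _ _
    _ = ∑ b, ∑ a, S.1 b j * (S.1 a i * Γ a b l) := h4
    _ = _ := by
      rw [Finset.sum_comm]
      exact Finset.sum_congr rfl fun a _ => Finset.sum_congr rfl fun b _ => by ring

/-- By invariance `Γ(x, ·)` is conjugate to `Γ(S x, ·)`, so the traces agree. -/
theorem transpose_mulVec_traceCovector (h : changeFrame S Γ = Γ) :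
    S.1ᵀ *ᵥ Γ.traceCovector = Γ.traceCovector := by
  funext i
  have h2 := congrArg Matrix.trace (changeFrame_eq S Γ i)
  have h3 : S⁻¹.1ᵀ * S.1ᵀ = 1 := by
    rw [← Matrix.transpose_mul, ← Units.val_mul]
    simp
  rw [h, Matrix.trace_mul_comm, ← Matrix.mul_assoc, h3, Matrix.one_mul, Matrix.trace_sum] at h2
  simp only [Matrix.trace_smul, smul_eq_mul] at h2
  exact h2.symm

/-- With `ω` the invariant trace covector, `ω(Γ(Sx, Sy)) = ω(S Γ(x, y)) = ω(Γ(x, y))`. -/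
theorem transpose_mul_traceForm_mul (h : changeFrame S Γ = Γ) :
    S.1ᵀ * Γ.traceForm * S.1 = Γ.traceForm := by
  ext i j
  have hω : ∀ n, Γ.traceCovector n = ∑ l, S.1 l n * Γ.traceCovector l := fun n =>
    (congrFun (transpose_mulVec_traceCovector h) n).symm
  symm
  calc
    Γ.traceForm i j = ∑ n, ∑ l, Γ i j n * (S.1 l n * Γ.traceCovector l) := by
      simp only [traceForm, Matrix.of_apply, ← Finset.mul_sum, ← hω]
    _ = ∑ l, (∑ n, S.1 l n * Γ i j n) * Γ.traceCovector l := by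
      rw [Finset.sum_comm]
      simp only [Finset.sum_mul]
      exact Finset.sum_congr rfl fun l _ => Finset.sum_congr rfl fun n _ => by ring
    _ = ∑ l, ∑ a, ∑ b, S.1 a i * S.1 b j * Γ a b l * Γ.traceCovector l := by
      simp only [sum_mul_of_changeFrame_eq h, Finset.sum_mul]
    _ = ∑ b, ∑ a, ∑ l, S.1 a i * S.1 b j * Γ a b l * Γ.traceCovector l := by
      rw [Finset.sum_comm, Finset.sum_comm (s := Finset.univ (α := Fin m)) (t := Finset.univ)
        (f := fun b a => ∑ l, S.1 a i * S.1 b j * Γ a b l * Γ.traceCovector l)]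
      exact Finset.sum_congr rfl fun a _ => Finset.sum_comm
    _ = (S.1ᵀ * Γ.traceForm * S.1) i j := by
      simp only [Matrix.mul_apply, Matrix.transpose_apply, traceForm, Matrix.of_apply,
        Finset.mul_sum, Finset.sum_mul]
      exact Finset.sum_congr rfl fun b _ => Finset.sum_congr rfl fun a _ =>
        Finset.sum_congr rfl fun l _ => by ring

/-- Taking adjugates in `Sᵀ b S = b` and using `det S = 1` gives `S adj(b) Sᵀ = adj(b)`; applied to
`ω = Sᵀ ω` this fixes the first vector. The adjugate replaces an inverse so that everything stays
polynomial in `Γ`. Later vectors are fixed because `S Γ(v, v) = Γ(S v, S v)`. -/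
theorem mulVec_vec (h : changeFrame S Γ = Γ) (hS : S.1.det = 1) (k : ℕ) :
    S.1 *ᵥ Γ.vec k = Γ.vec k := by
  induction k with
  | zero =>
    have h1 : S.1 * Γ.traceForm.adjugate * S.1ᵀ = Γ.traceForm.adjugate := by
      have h2 := congrArg Matrix.adjugate (transpose_mul_traceForm_mul h)
      rw [Matrix.adjugate_mul_distrib, Matrix.adjugate_mul_distrib] at h2
      rw [← h2, ← Matrix.mul_assoc, ← Matrix.mul_assoc, Matrix.mul_adjugate, hS, one_smul,
        Matrix.one_mul, Matrix.mul_assoc, Matrix.adjugate_mul, Matrix.det_transpose, hS, one_smul,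
        Matrix.mul_one]
      rw [h2]
    rw [vec]
    conv_lhs => rw [← transpose_mulVec_traceCovector h]
    rw [Matrix.mulVec_mulVec, Matrix.mulVec_mulVec, h1]
  | succ k ih =>
    funext l
    have hv : ∀ a, Γ.vec k a = ∑ i, S.1 a i * Γ.vec k i := fun a => (congrFun ih a).symm
    calc
      (S.1 *ᵥ Γ.vec (k + 1)) l
        = ∑ c, ∑ i, ∑ j, S.1 l c * (Γ.vec k i * Γ.vec k j * Γ i j c) := by
          simp only [Matrix.mulVec, dotProduct, vec, Finset.mul_sum]
      _ = ∑ i, ∑ j, Γ.vec k i * Γ.vec k j * ∑ c, S.1 l c * Γ i j c := by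
          rw [Finset.sum_comm]
          refine Finset.sum_congr rfl fun i _ => ?_
          rw [Finset.sum_comm]
          refine Finset.sum_congr rfl fun j _ => ?_
          rw [Finset.mul_sum]
          exact Finset.sum_congr rfl fun c _ => by ring
      _ = ∑ i, ∑ j, ∑ a, ∑ b, S.1 a i * Γ.vec k i * (S.1 b j * Γ.vec k j) * Γ a b l := by
          simp only [sum_mul_of_changeFrame_eq h, Finset.mul_sum]
          exact Finset.sum_congr rfl fun i _ => Finset.sum_congr rfl fun j _ =>
            Finset.sum_congr rfl fun a _ => Finset.sum_congr rfl fun b _ => by ring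
      _ = ∑ a, ∑ b, ∑ i, ∑ j, S.1 a i * Γ.vec k i * (S.1 b j * Γ.vec k j) * Γ a b l := by
          calc
            _ = ∑ i, ∑ a, ∑ j, ∑ b, S.1 a i * Γ.vec k i * (S.1 b j * Γ.vec k j) * Γ a b l :=
              Finset.sum_congr rfl fun i _ => Finset.sum_comm
            _ = ∑ i, ∑ a, ∑ b, ∑ j, S.1 a i * Γ.vec k i * (S.1 b j * Γ.vec k j) * Γ a b l :=
              Finset.sum_congr rfl fun i _ => Finset.sum_congr rfl fun a _ => Finset.sum_comm
            _ = ∑ a, ∑ i, ∑ b, ∑ j, S.1 a i * Γ.vec k i * (S.1 b j * Γ.vec k j) * Γ a b l :=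
              Finset.sum_comm
            _ = _ := Finset.sum_congr rfl fun a _ => Finset.sum_comm
      _ = ∑ a, ∑ b, Γ.vec k a * Γ.vec k b * Γ a b l := by
          refine Finset.sum_congr rfl fun a _ => Finset.sum_congr rfl fun b _ => ?_
          rw [hv a, hv b, Finset.sum_mul_sum, Finset.sum_mul]
          exact Finset.sum_congr rfl fun i _ => (Finset.sum_mul _ _ _).symm
      _ = Γ.vec (k + 1) l := rfl

theorem eq_one_of_changeFrame_eq (h : changeFrame S Γ = Γ) (hS : S.1.det = 1)
    (hΓ : Γ.frameDet ≠ 0) : S = 1 := by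
  set M : Matrix (Fin m) (Fin m) ℝ := Matrix.of fun k : Fin m => Γ.vec k with hM
  have h1 : M * S.1ᵀ = M * 1 := by
    rw [Matrix.mul_one]
    ext k l
    rw [Matrix.mul_apply]
    refine Eq.trans ?_ (congrFun (mulVec_vec h hS k) l)
    exact Finset.sum_congr rfl fun c _ => mul_comm _ _
  have hu : IsUnit M := (Matrix.isUnit_iff_isUnit_det M).2 (isUnit_iff_ne_zero.2 hΓ)
  have h2 := hu.mul_left_cancel h1
  refine Units.ext ?_
  rw [← Matrix.transpose_transpose S.1, h2, Matrix.transpose_one, Units.val_one]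

end Stabilizer

/-- Preserving the nondegenerate symmetric Ricci tensor forces the squared determinant to be one;
positivity in `GL⁺` selects the root `1`. -/
theorem stabilizer_eq_bot {p q : ℕ} (hpq : (p, q) = (m, 0) ∨ (p, q) = (0, m)) {Γ : Christoffel m}
    (hW : Γ ∈ W m p q) (hΓ : Γ.frameDet ≠ 0) : MulAction.stabilizer GL(m, ℝ)⁺ Γ = ⊥ := by
  obtain ⟨c, hc⟩ := exists_hasSignature_iff hpq
  rw [Subgroup.eq_bot_iff_forall]
  intro T hT
  have hT' : changeFrame (T : GL (Fin m) ℝ)⁻¹ Γ = Γ := hT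
  have hρ : Γ.symRicci.det ≠ 0 := by
    intro h0
    obtain ⟨x, hx, hx0⟩ := Matrix.exists_mulVec_eq_zero_iff.2 h0
    have h1 := (hc Γ).1 hW x hx
    rw [Matrix.smul_mulVec, hx0, smul_zero, dotProduct_zero] at h1
    exact h1.false
  have hpos : 0 < ((T : GL (Fin m) ℝ)⁻¹).1.det := (T⁻¹).2
  have hdet : ((T : GL (Fin m) ℝ)⁻¹).1.det = 1 := by
    have h1 := congrArg Matrix.det (symRicci_changeFrame (T : GL (Fin m) ℝ)⁻¹ Γ)
    rw [hT', Matrix.det_mul, Matrix.det_mul, Matrix.det_transpose] at h1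
    have h2 : ((T : GL (Fin m) ℝ)⁻¹).1.det * ((T : GL (Fin m) ℝ)⁻¹).1.det = 1 :=
      mul_right_cancel₀ hρ (by linarith)
    nlinarith
  have h3 := eq_one_of_changeFrame_eq hT' hdet hΓ
  exact Subtype.ext (inv_eq_one.1 h3)

/-! ### A torsion free example with nonzero frame determinant. -/

/-- The Christoffel symbols with `Γ(e_i, e_i) = e_0 + e_{i+1}` for `i < m - 1`,
`Γ(e_{m-1}, e_{m-1}) = e_0` and all other components zero. -/
def chain (m : ℕ) : Christoffel m := fun i j k =>
  if i = j then (if k.val = 0 then 1 else 0) + (if k.val = i.val + 1 then 1 else 0) else 0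

theorem chain_mem_symm : chain m ∈ symm m := by
  intro i j k
  by_cases h : i = j
  · rw [h]
  · simp [chain, h, Ne.symm h]

theorem traceCovector_chain (i : Fin m) :
    (chain m).traceCovector i = if i.val = 0 then 1 else 0 := by
  simp [traceCovector, chain, Finset.sum_ite_eq]

/-- The trace covector is the coordinate of `e_0`, and the summand `e_0` in every `Γ(e_i, e_i)` is
there to make this form the identity. -/
theorem traceForm_chain : (chain m).traceForm = 1 := by
  ext i j
  have hm : 0 < m := i.pos
  simp only [traceForm, Matrix.of_apply, traceCovector_chain]
  rw [Finset.sum_eq_single (⟨0, hm⟩ : Fin m)]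
  · simp [chain, Matrix.one_apply]
  · intro n _ hn
    have : n.val ≠ 0 := fun h => hn (Fin.ext h)
    simp [this]
  · simp

/-- Away from coordinate `0`, the map `v ↦ Γ(v, v)` squares the coordinates and shifts them by one.
-/
theorem vec_chain_succ (k : ℕ) (c : Fin m) (hc : c.val ≠ 0) :
    (chain m).vec (k + 1) c = (chain m).vec k ⟨c.val - 1, by lia⟩ ^ 2 := by
  change ∑ a, ∑ b, (chain m).vec k a * (chain m).vec k b * chain m a b c = _
  rw [Finset.sum_eq_single (⟨c.val - 1, by lia⟩ : Fin m)]
  · rw [Finset.sum_eq_single (⟨c.val - 1, by lia⟩ : Fin m)]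
    · have : c.val = c.val - 1 + 1 := by lia
      simp only [chain, if_true, hc, if_false, ← this]
      ring
    · intro b _ hb
      simp [chain, hb.symm]
    · simp
  · intro a _ ha
    refine Finset.sum_eq_zero fun b _ => ?_
    have : c.val ≠ a.val + 1 := fun h => ha (Fin.ext (by simp [h]))
    simp [chain, hc, this]
  · simp

/-- The first vector is `e_0`, and each squaring and shift moves the final entry `1` one place on,
so the frame matrix is unitriangular. -/
theorem vec_chain (k : ℕ) (c : Fin m) :
    (k < c.val → (chain m).vec k c = 0) ∧ (k = c.val → (chain m).vec k c = 1) := by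
  induction k generalizing c with
  | zero =>
    rw [vec, traceForm_chain, Matrix.adjugate_one, Matrix.one_mulVec, traceCovector_chain]
    refine ⟨fun h => if_neg h.ne', fun h => if_pos h.symm⟩
  | succ k ih =>
    refine ⟨fun h => ?_, fun h => ?_⟩
    · rw [vec_chain_succ k c (by lia), (ih _).1 (by simp only; lia)]
      norm_num
    · rw [vec_chain_succ k c (by lia), (ih _).2 (by simp only; lia)]
      norm_num

theorem frameDet_chain : (chain m).frameDet = 1 := by
  rw [frameDet, Matrix.det_of_isLowerTriangular]
  · exact Finset.prod_eq_one fun i _ => (vec_chain i.val i).2 rfl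
  · intro i j hij
    exact (vec_chain i.val j).1 hij

variable {p q : ℕ}

theorem dense_WTilde (hpq : (p, q) = (m, 0) ∨ (p, q) = (0, m)) :
    Dense {Γ : W m p q | Γ.1 ∈ WTilde m p q} := by
  have hne : frameDet (chain m) ≠ 0 := by
    rw [frameDet_chain]
    exact one_ne_zero
  refine Dense.mono ?_ (dense_ne_zero_of_contDiff_omega contDiff_frameDet hne (isOpen_W hpq))
  exact fun Γ hΓ => ⟨Γ.2, stabilizer_eq_bot hpq Γ.2 hΓ⟩

/-- Density in the larger space says nothing about a subspace; it is because `chain` is torsion free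
that the restricted polynomial is still nonzero. -/
theorem dense_ZTilde (hpq : (p, q) = (m, 0) ∨ (p, q) = (0, m)) :
    Dense {Γ : Z m p q | Γ.1 ∈ ZTilde m p q} := by
  have hf : ContDiff ℝ ω fun Γ : symm m => frameDet (Γ : Christoffel m) :=
    contDiff_frameDet.comp (symm m).subtypeL.contDiff
  have hne : frameDet ((⟨chain m, chain_mem_symm⟩ : symm m) : Christoffel m) ≠ 0 := by
    rw [frameDet_chain]
    exact one_ne_zero
  refine Dense.mono ?_ (dense_ne_zero_of_contDiff_omega hf hne (isOpen_Z hpq))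
  refine fun Γ hΓ => ⟨Γ.2, ?_⟩
  rw [Subgroup.eq_bot_iff_forall]
  intro T hT
  rw [← Subgroup.mem_bot, ← stabilizer_eq_bot hpq Γ.2 hΓ]
  exact congrArg Subtype.val hT

end Christoffel

end

theorem theorem1p8 (m : ℕ) (hm : 3 ≤ m) (p q : ℕ)
    (hpq : (p, q) = (m, 0) ∨ (p, q) = (0, m)) :
    (IsProperAction GL(m, ℝ)⁺ (Christoffel.W m p q) ∧
      IsProperAction GL(m, ℝ)⁺ (Christoffel.Z m p q)) ∧
    ((IsOpen {Γ : Christoffel.W m p q | Γ.1 ∈ Christoffel.WTilde m p q} ∧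
        Dense {Γ : Christoffel.W m p q | Γ.1 ∈ Christoffel.WTilde m p q}) ∧
      (IsOpen {Γ : Christoffel.Z m p q | Γ.1 ∈ Christoffel.ZTilde m p q} ∧
        Dense {Γ : Christoffel.Z m p q | Γ.1 ∈ Christoffel.ZTilde m p q})) ∧
    ((∃ hW : IsOpen (Christoffel.WTilde m p q : Set (Christoffel m)),
        HasPrincipalQuotient (Fin m → Fin m → ℝ) (Christoffel.WTilde m p q) hW) ∧
      (∃ hZ : IsOpen (Christoffel.ZTilde m p q : Set (Christoffel.symm m)),
        HasPrincipalQuotient (Fin m → Fin m → ℝ) (Christoffel.ZTilde m p q) hZ)) := by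
  have hpW := Christoffel.isProperAction_W hpq
  have hpZ := Christoffel.isProperAction_Z hpq
  have hW := Christoffel.isSmoothAction.isOpen_trivialIsotropy (Christoffel.isOpen_W hpq) hpW
  have hZ := Christoffel.isSmoothAction_symm.isOpen_trivialIsotropy (Christoffel.isOpen_Z hpq) hpZ
  exact ⟨⟨hpW, hpZ⟩,
    ⟨⟨hW.preimage continuous_subtype_val, Christoffel.dense_WTilde hpq⟩,
      ⟨hZ.preimage continuous_subtype_val, Christoffel.dense_ZTilde hpq⟩⟩,
    ⟨hW, Christoffel.isSmoothAction.hasPrincipalQuotient (Christoffel.isOpen_W hpq) hpW⟩,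
    ⟨hZ, Christoffel.isSmoothAction_symm.hasPrincipalQuotient (Christoffel.isOpen_Z hpq) hpZ⟩⟩
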